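/- **Setting.** Let $T=S^1\times S^1$ with angular coordinates $(m,l)$ (each of period $2\pi$), the product metric and the orientation $dm\wedge dl$. Identify $su(2)=\mathbb R i\oplus\mathbb R j\oplus\mathbb R k=\mathbb R i\oplus\mathbb C j$ with the imaginary quaternions, with bracket $[x,y]=xy-yx$, and let $L^2=L^2(\Omega^{0+1+2}(T;su(2)))$ be the real Hilbert space of square integrable $su(2)$-valued forms, with the inner product $-\int_T\mathrm{tr}(\cdot\wedge *\,\cdot)$. Put $J(\alpha,\beta,\gamma)=(-*\gamma,*\beta,*\alpha)$. A subspace $\Lambda\subset L^2$ is *Lagrangian* if $J\Lambda=\Lambda^\perp$; a subspace $\Lambda$ of a $J$-invariant subspace $H$ is Lagrangian in $H$ if $J\Lambda=\Lambda^\perp\cap H$. Families of closed subspaces are called continuous, and limits of them are taken, in the gap topology, i.e. the norm topology on orthogonal projections. For $(\alpha,\beta)\in\mathbb R^2$ let $a_{\alpha,\beta}=-i\alpha\,dm-i\beta\,dl$, $d_a=d+[a,\cdot\,]$, and let $$S_{\alpha,\beta}(\sigma,\tau,\omega)=(*d_a\tau,\;-*d_a\sigma-d_a{*\omega},\;d_a{*\tau}),\qquad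 a=a_{\alpha,\beta},$$ on smooth forms in $\Omega^{0+1+2}(T;su(2))$. Let $P^+_{\alpha,\beta}$ (resp. $P^-_{\alpha,\beta}$) be the closed span in $L^2$ of the smooth eigenforms of $S_{\alpha,\beta}$ with positive (resp. negative) eigenvalue. Put $P^\pm_{\mathbb R i}=P^\pm_{\alpha,\beta}\cap L^2(\Omega^{0+1+2}(T;\mathbb R i))$ and $P^\pm_{\mathbb C j,(\alpha,\beta)}=P^\pm_{\alpha,\beta}\cap L^2(\Omega^{0+1+2}(T;\mathbb C j))$, and let $\mathcal H^{0+1+2}(T;\mathbb R i)$ be the space of smooth $\mathbb R i$-valued forms in the kernel of the untwisted Laplacian. For $\theta\in S^1\subset\mathbb C$ let $$K^\pm_{(\alpha,\beta,\theta)}=\Big(\lim_{t\to0^+}P^\pm_{(\alpha,\beta)+t(\mathrm{Re}\,\theta,\mathrm{Im}\,\theta)}\Big)\Big/P^\pm_{\alpha,\beta},$$ realised as the orthogonal complement of $P^\pm_{\alpha,\beta}$ in the limit. Let $\widetilde{\mathbb R}^2=(\mathbb R^2\times S^1)/\!\sim$, where $(\alpha,\beta,\theta)\sim(\alpha,\beta,1)$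 if $(\alpha,\beta)\notin(\frac12\mathbb Z)^2$. Its topology is the one for which the following bijection $h$ from $\mathbb R^2=\mathbb C$ with the open disks of radius $\frac18$ around the points of $(\frac12\mathbb Z)^2$ removed onto $\widetilde{\mathbb R}^2$ is a homeomorphism: if $|z-p|\le\frac14$ with $p\in(\frac12\mathbb Z)^2$, then $h(z)=\big(p+\eta(|z-p|)(z-p),\frac{z-p}{|z-p|}\big)$, and $h(z)=z$ if $z$ has distance at least $\frac14$ from $(\frac12\mathbb Z)^2$. Here $\eta:\mathbb R\to[0,1]$ is any smooth function that is $0$ on $(-\infty,\frac18]$, is $1$ on $[\frac14,\infty)$ and restricts to a homeomorphism $[\frac18,\frac14]\to[0,1]$. **Theorem.** The limits in the definition of $K^\pm_{(\alpha,\beta,\theta)}$ exist and contain $P^\pm_{\alpha,\beta}$, and $K^\pm_{(\alpha,\beta,\theta)}=0$ for $(\alpha,\beta)\notin(\frac12\mathbb Z)^2$, so that $K^\pm$ is well defined on $\widetilde{\mathbb R}^2$. Let $U\subset\widetilde{\mathbb R}^2$ be a subset (for example $U=\widetilde{\mathbb R}^2$) and let $L=(L_u)_{u\in U}$ be a continuous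 family of Lagrangian subspaces of $\mathcal H^{0+1+2}(T;\mathbb R i)$. Then $$\mathcal P^\pm_{(\alpha,\beta,\theta)}(L)=(P^\pm_{\mathbb R i}\oplus L_{(\alpha,\beta,\theta)})\oplus(P^\pm_{\mathbb C j,(\alpha,\beta)}\oplus K^\pm_{(\alpha,\beta,\theta)}),\qquad(\alpha,\beta,\theta)\in U,$$ is a continuous family of Lagrangian subspaces of $L^2(\Omega^{0+1+2}(T;su(2)))$. They are Atiyah–Patodi–Singer boundary conditions: $\mathcal P^+_{(\alpha,\beta,\theta)}(L)$ (resp. $\mathcal P^-_{(\alpha,\beta,\theta)}(L)$) contains all eigenvectors of $S_{\alpha,\beta}$ with sufficiently large positive (resp. sufficiently large negative) eigenvalue. -/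

import Mathlib

open scoped Real Quaternion Topology ContDiff
open MeasureTheory Filter Set

noncomputable section

namespace TorusAPS

/-! ### The Lie algebra `su(2)` as imaginary quaternions -/

/-- `su(2) = ℝi ⊕ ℝj ⊕ ℝk`, the imaginary quaternions, with the Euclidean inner product. -/
def su2 : Submodule ℝ ℍ[ℝ] where
  carrier := {q | q.re = 0}
  add_mem' := by
    intro a b ha hb
    simp only [mem_ofPred_eq, Quaternion.re_add] at *
    rw [ha, hb, add_zero]
  zero_mem' := by simp
  smul_mem' := by
    intro c a ha
    simp only [mem_ofPred_eq, Quaternion.re_smul] at *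
    rw [ha, smul_zero]

instance : CompleteSpace su2 := FiniteDimensional.complete ℝ su2

/-- The Lie bracket `[x, y] = xy - yx`. -/
def bracket (x y : su2) : su2 :=
  ⟨(x : ℍ[ℝ]) * y - (y : ℍ[ℝ]) * x, by
    change ((x : ℍ[ℝ]) * y - (y : ℍ[ℝ]) * x).re = 0
    simp only [Quaternion.re_sub, Quaternion.re_mul]
    ring⟩

/-- The imaginary unit `i`. -/
def unitI : su2 := ⟨⟨0, 1, 0, 0⟩, rfl⟩

/-- The line `ℝi ⊆ su(2)`. -/
def lineI : Submodule ℝ su2 where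
  carrier := {q | (q : ℍ[ℝ]).imJ = 0 ∧ (q : ℍ[ℝ]).imK = 0}
  add_mem' := by
    rintro a b ⟨ha, ha'⟩ ⟨hb, hb'⟩
    simp [ha, ha', hb, hb']
  zero_mem' := by simp
  smul_mem' := by
    rintro c a ⟨ha, ha'⟩
    simp [ha, ha']

/-- The plane `ℂj = ℝj ⊕ ℝk ⊆ su(2)`. -/
def planeJ : Submodule ℝ su2 where
  carrier := {q | (q : ℍ[ℝ]).imI = 0}
  add_mem' := by
    intro a b ha hb
    simp only [mem_ofPred_eq] at *
    simp [ha, hb]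
  zero_mem' := by simp
  smul_mem' := by
    intro c a ha
    simp only [mem_ofPred_eq] at *
    simp [ha]

/-! ### The torus and its differential forms -/

instance : Fact (0 < 2 * π) := ⟨Real.two_pi_pos⟩

/-- The flat torus `S¹ × S¹` with angular coordinates `(m, l)`, each of period `2π`; its measure
`volume` is the Riemannian one, of total mass `4π²`. -/
abbrev Torus : Type := AddCircle (2 * π) × AddCircle (2 * π)

/-- Values of `su(2)`-valued forms of degree `0+1+2`: the vector `!₂[f, g, h, k]` stands for
`f + g dm + h dl + k dm ∧ dl`. The frame `1, dm, dl, dm ∧ dl` is orthonormal. -/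
abbrev Fiber : Type := PiLp 2 (fun _ : Fin 4 => su2)

/-- Not necessarily smooth elements of `Ω^{0+1+2}(T; su(2))`. -/
abbrev Form : Type := Torus → Fiber

/-- A form is smooth if its pullback to the universal cover `ℝ²` is `C^∞`. -/
def IsSmooth (φ : Form) : Prop :=
  ContDiff ℝ ∞ (fun p : ℝ × ℝ => φ ((p.1 : AddCircle (2 * π)), (p.2 : AddCircle (2 * π))))

/-- The partial derivative `∂/∂m`. -/
def partialM (u : Torus → su2) (x : Torus) : su2 :=
  deriv (fun t : ℝ => u (x.1 + (t : AddCircle (2 * π)), x.2)) 0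

/-- The partial derivative `∂/∂l`. -/
def partialL (u : Torus → su2) (x : Torus) : su2 :=
  deriv (fun t : ℝ => u (x.1, x.2 + (t : AddCircle (2 * π)))) 0

/-- The `SU(2)` connection `m dm + l dl` on the trivial bundle over the torus. -/
structure Connection where
  /-- the coefficient of `dm` -/
  m : Torus → su2
  /-- the coefficient of `dl` -/
  l : Torus → su2

/-- The `dm`-component `∂ₘ u + [aₘ, u]` of `d_a u` for a function `u`. -/
def covM (a : Connection) (u : Torus → su2) (x : Torus) : su2 :=
  partialM u x + bracket (a.m x) (u x)

/-- The `dl`-component `∂ₗ u + [aₗ, u]` of `d_a u` for a function `u`. -/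
def covL (a : Connection) (u : Torus → su2) (x : Torus) : su2 :=
  partialL u x + bracket (a.l x) (u x)

/-- The covariant derivative `d_a = d + [a, ·]` on `Ω^{0+1+2}(T; su(2))`. -/
def dA (a : Connection) (φ : Form) : Form := fun x =>
  !₂[0, covM a (fun y => φ y 0) x, covL a (fun y => φ y 0) x,
    covM a (fun y => φ y 2) x - covL a (fun y => φ y 1) x]

/-- The Hodge star on values: `*1 = dm ∧ dl`, `*dm = dl`, `*dl = -dm`, `*(dm ∧ dl) = 1`. -/
def hodge (v : Fiber) : Fiber := !₂[v 3, -v 2, v 1, v 0]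

/-- The Hodge star on forms. -/
def hodgeForm (φ : Form) : Form := fun x => hodge (φ x)

/-- The part of degree `0`. -/
def deg0 (v : Fiber) : Fiber := !₂[v 0, 0, 0, 0]

/-- The part of degree `1`. -/
def deg1 (v : Fiber) : Fiber := !₂[0, v 1, v 2, 0]

/-- The part of degree `2`. -/
def deg2 (v : Fiber) : Fiber := !₂[0, 0, 0, v 3]

/-- The twisted de Rham operator
`S_a (α, β, γ) = (*d_a β, -*d_a α - d_a *γ, d_a *β)`. -/
def deRhamOp (a : Connection) (φ : Form) : Form :=
  let α : Form := fun x => deg0 (φ x)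
  let β : Form := fun x => deg1 (φ x)
  let γ : Form := fun x => deg2 (φ x)
  hodgeForm (dA a β) + (-hodgeForm (dA a α) - dA a (hodgeForm γ)) + dA a (hodgeForm β)

/-- The codifferential `d_a^* = -* d_a *`. -/
def dAstar (a : Connection) (φ : Form) : Form := -hodgeForm (dA a (hodgeForm φ))

/-- The twisted Laplacian `Δ_a = d_a d_a^* + d_a^* d_a`. -/
def laplacian (a : Connection) (φ : Form) : Form := dA a (dAstar a φ) + dAstar a (dA a φ)

/-- The trivial connection. -/
def trivialConn : Connection := ⟨fun _ => 0, fun _ => 0⟩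

/-- The flat connection `a_{α,β} = -iα dm - iβ dl`, for `ρ = α + iβ ∈ ℂ = ℝ²`. -/
def flatConn (ρ : ℂ) : Connection := ⟨fun _ => -(ρ.re • unitI), fun _ => -(ρ.im • unitI)⟩

/-! ### The symplectic Hilbert space `L²(Ω^{0+1+2}(T; su(2)))` -/

/-- The real Hilbert space `L²(Ω^{0+1+2}(T; su(2)))`. -/
abbrev L2 : Type := Lp Fiber 2 (volume : Measure Torus)

/-- `J (α, β, γ) = (-*γ, *β, *α)` on values. -/
def fiberJ : Fiber →ₗ[ℝ] Fiber where
  toFun v := -hodge (deg2 v) + hodge (deg1 v) + hodge (deg0 v)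
  map_add' v w := by
    refine PiLp.ext fun i => ?_
    fin_cases i <;> simp [hodge, deg0, deg1, deg2, add_comm]
  map_smul' c v := by
    refine PiLp.ext fun i => ?_
    fin_cases i <;> simp [hodge, deg0, deg1, deg2]

/-- The almost complex structure `J` on `L²(Ω^{0+1+2}(T; su(2)))`. -/
def J : L2 →L[ℝ] L2 := ContinuousLinearMap.compLpL 2 volume (LinearMap.toContinuousLinearMap fiberJ)

/-- `Λ` is a Lagrangian subspace of `L²`: `J Λ = Λ^⊥`. -/
def IsLagrangian (Λ : Submodule ℝ L2) : Prop := Λ.map (J : L2 →ₗ[ℝ] L2) = Λᗮ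

/-- `Λ` is a Lagrangian subspace of the `J`-invariant subspace `H` of `L²`: `J Λ` is the
orthogonal complement of `Λ` in `H`. -/
def IsLagrangianIn (H Λ : Submodule ℝ L2) : Prop :=
  Λ ≤ H ∧ Λ.map (J : L2 →ₗ[ℝ] L2) = Λᗮ ⊓ H

/-- The orthogonal projection onto (the closure of) `V`. For closed subspaces the distance
`‖gapProj V - gapProj W‖` is the gap metric. -/
def gapProj (V : Submodule ℝ L2) : L2 →L[ℝ] L2 := V.topologicalClosure.starProjection

/-- The limit in the gap topology of a family of closed subspaces (provided that it exists, see
`gapLim_eq`): the `x` with `proj_{F t} x → x`. -/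
def gapLim (F : ℝ → Submodule ℝ L2) (f : Filter ℝ) : Submodule ℝ L2 where
  carrier := {x | Tendsto (fun t => gapProj (F t) x) f (𝓝 x)}
  add_mem' := by
    intro x y hx hy
    simp only [mem_ofPred_eq, map_add] at *
    exact hx.add hy
  zero_mem' := by
    simp only [mem_ofPred_eq, map_zero]
    exact tendsto_const_nhds
  smul_mem' := by
    intro c x hx
    simp only [mem_ofPred_eq, map_smul] at *
    exact hx.const_smul c

theorem gapLim_eq {F : ℝ → Submodule ℝ L2} {f : Filter ℝ} [f.NeBot] {V : Submodule ℝ L2}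
    (hV : IsClosed (V : Set L2))
    (h : Tendsto (fun t => gapProj (F t)) f (𝓝 (gapProj V))) : gapLim F f = V := by
  ext x
  have hx : Tendsto (fun t => gapProj (F t) x) f (𝓝 (gapProj V x)) :=
    ((ContinuousLinearMap.apply ℝ L2 x).continuous.tendsto _).comp h
  have hc : V.topologicalClosure = V := hV.submodule_topologicalClosure_eq
  have key : x ∈ V ↔ gapProj V x = x := by
    unfold gapProj
    rw [Submodule.starProjection_eq_self_iff, hc]
  rw [key]
  constructor
  · intro h'
    exact tendsto_nhds_unique hx h'
  · intro h'
    change Tendsto (fun t => gapProj (F t) x) f (𝓝 x)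
    rwa [h'] at hx

/-! ### Spectral subspaces -/

/-- The `μ`-eigenspace `E_{a,μ}` of `S_a`, viewed in `L²`. -/
def eigenforms (a : Connection) (μ : ℝ) : Set L2 :=
  {ψ | ∃ φ : Form, IsSmooth φ ∧ deRhamOp a φ = μ • φ ∧ ψ =ᵐ[volume] φ}

/-- `P^+_a` (for `ε = 1`) and `P^-_a` (for `ε = -1`): the closed span in `L²` of the eigenforms
of `S_a` with positive, respectively negative, eigenvalue. -/
def spectralSpace (ε : ℤˣ) (a : Connection) : Submodule ℝ L2 :=
  (Submodule.span ℝ {ψ | ∃ μ : ℝ, 0 < ((ε : ℤ) : ℝ) * μ ∧ ψ ∈ eigenforms a μ}).topologicalClosure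

/-- `L²(Ω^{0+1+2}(T; W))` for a subspace `W` of `su(2)`. -/
def formsIn (W : Submodule ℝ su2) : Submodule ℝ L2 where
  carrier := {ψ | ∀ᵐ x ∂(volume : Measure Torus), ∀ c, ψ x c ∈ W}
  add_mem' := by
    intro φ ψ hφ hψ
    simp only [mem_ofPred_eq] at *
    filter_upwards [hφ, hψ, Lp.coeFn_add φ ψ] with x h1 h2 h3 c
    rw [h3]
    exact W.add_mem (h1 c) (h2 c)
  zero_mem' := by
    simp only [mem_ofPred_eq]
    filter_upwards [Lp.coeFn_zero Fiber 2 (volume : Measure Torus)] with x h c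
    rw [h]
    exact W.zero_mem
  smul_mem' := by
    intro r φ hφ
    simp only [mem_ofPred_eq] at *
    filter_upwards [hφ, Lp.coeFn_smul r φ] with x h1 h3 c
    rw [h3]
    exact W.smul_mem r (h1 c)

/-- The untwisted harmonic forms `H^{0+1+2}(T; ℝi)`, i.e. the kernel of the untwisted Laplacian
on smooth `ℝi`-valued forms, viewed in `L²`. -/
def harmonicI : Submodule ℝ L2 :=
  Submodule.span ℝ {ψ | ∃ φ : Form, IsSmooth φ ∧ (∀ x c, φ x c ∈ lineI) ∧
    laplacian trivialConn φ = 0 ∧ ψ =ᵐ[volume] φ}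

/-- `Λ` is an Atiyah–Patodi–Singer boundary condition for `S_a`: a Lagrangian subspace that
contains all eigenvectors of `S_a` with sufficiently large eigenvalues (for `ε = 1`),
respectively with sufficiently large negative eigenvalues (for `ε = -1`). -/
def IsAPSBoundaryCondition (ε : ℤˣ) (a : Connection) (Λ : Submodule ℝ L2) : Prop :=
  IsLagrangian Λ ∧ ∃ ν : ℝ, ∀ μ : ℝ, ν < ((ε : ℤ) : ℝ) * μ → eigenforms a μ ⊆ (Λ : Set L2)

/-- The limit `lim_{t → 0⁺} P^±_{ρ + tθ}` in the gap topology. -/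
def limitSpace (ε : ℤˣ) (ρ : ℂ) (θ : Circle) : Submodule ℝ L2 :=
  gapLim (fun t : ℝ => spectralSpace ε (flatConn (ρ + (t : ℂ) * (θ : ℂ)))) (𝓝[>] 0)

/-- `K^±_{(ρ,θ)} = (lim_{t → 0⁺} P^±_{ρ + tθ}) / P^±_ρ`, realised as the orthogonal complement of
`P^±_ρ` in the limit. -/
def limitK (ε : ℤˣ) (ρ : ℂ) (θ : Circle) : Submodule ℝ L2 :=
  limitSpace ε ρ θ ⊓ (spectralSpace ε (flatConn ρ))ᗮ

/-- `(P^±_{ℝi} ⊕ Λ) ⊕ (P^±_{ℂj,ρ} ⊕ K^±_{(ρ,θ)})`. -/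
def apsSpace (ε : ℤˣ) (ρ : ℂ) (θ : Circle) (Λ : Submodule ℝ L2) : Submodule ℝ L2 :=
  ((spectralSpace ε (flatConn ρ) ⊓ formsIn lineI) ⊔ Λ) ⊔
    ((spectralSpace ε (flatConn ρ) ⊓ formsIn planeJ) ⊔ limitK ε ρ θ)

/-! ### The blown-up plane -/

/-- The half integer lattice `(½ℤ)²` in `ℂ = ℝ²`. -/
def halfLattice : Set ℂ := {z | ∃ r s : ℤ, z = ⟨(r : ℝ) / 2, (s : ℝ) / 2⟩}

/-- The equivalence relation on `ℝ² × S¹` that forgets the angle away from `(½ℤ)²`. -/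
def blowupSetoid : Setoid (ℂ × Circle) where
  r p q := p.1 = q.1 ∧ (p.1 ∈ halfLattice → p.2 = q.2)
  iseqv :=
    ⟨fun _ => ⟨rfl, fun _ => rfl⟩,
     fun h => ⟨h.1.symm, fun hq => (h.2 (h.1 ▸ hq)).symm⟩,
     fun h h' => ⟨h.1.trans h'.1, fun hp => (h.2 hp).trans (h'.2 (h.1 ▸ hp))⟩⟩

/-- The set `(ℝ² × S¹)/∼`. -/
def BlowupPlane : Type := Quotient blowupSetoid

/-- The class of `(ρ, θ)`. -/
def BlowupPlane.mk (ρ : ℂ) (θ : Circle) : BlowupPlane := Quotient.mk blowupSetoid (ρ, θ)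

/-- The projection `(ρ, θ) ↦ ρ` to the plane. -/
def BlowupPlane.pt : BlowupPlane → ℂ := Quotient.lift (fun p => p.1) (fun _ _ h => h.1)

open Classical in
/-- The angle `θ` of the normal form of a point: `(ρ, θ)` if `ρ ∈ (½ℤ)²`, and `(ρ, 1)` if not. -/
def BlowupPlane.angle : BlowupPlane → Circle :=
  Quotient.lift (fun p : ℂ × Circle => if p.1 ∈ halfLattice then p.2 else 1) (by
    intro p q h
    have h1 : p.1 = q.1 := h.1
    have h2 : p.1 ∈ halfLattice → p.2 = q.2 := h.2
    by_cases hp : p.1 ∈ halfLattice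
    · have hq : q.1 ∈ halfLattice := h1 ▸ hp
      simp [hp, hq, h2 hp]
    · have hq : q.1 ∉ halfLattice := h1 ▸ hp
      simp [hp, hq])

/-- The plane with the open disks of radius `1/8` around the points of `(½ℤ)²` removed. -/
abbrev PerforatedPlane : Type := {z : ℂ // ∀ p ∈ halfLattice, 1 / 8 ≤ ‖z - p‖}

/-- The cutoff functions `η : ℝ → [0, 1]`: smooth, `0` up to `1/8`, `1` from `1/4` on, and in
between a homeomorphism (i.e. a continuous bijection) `[1/8, 1/4] → [0, 1]`. -/
structure IsCutoff (η : ℝ → ℝ) : Prop where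
  smooth : ContDiff ℝ ∞ η
  zero : ∀ t ≤ 1 / 8, η t = 0
  one : ∀ t, 1 / 4 ≤ t → η t = 1
  bij : BijOn η (Icc (1 / 8) (1 / 4)) (Icc 0 1)

/-- The point of `(½ℤ)²` that is nearest to `z`. -/
def nearest (z : ℂ) : ℂ := ⟨(round (2 * z.re) : ℝ) / 2, (round (2 * z.im) : ℝ) / 2⟩

theorem nearest_mem (z : ℂ) : nearest z ∈ halfLattice := ⟨_, _, rfl⟩

theorem nearest_eq {z p : ℂ} (hp : p ∈ halfLattice) (h : ‖z - p‖ < 1 / 4) : nearest z = p := by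
  obtain ⟨r, s, rfl⟩ := hp
  have h1 := abs_lt.mp ((Complex.abs_re_le_norm _).trans_lt h)
  have h2 := abs_lt.mp ((Complex.abs_im_le_norm _).trans_lt h)
  simp only [Complex.sub_re, Complex.sub_im] at h1 h2
  have e1 : round (2 * z.re) = r := round_eq_iff.mpr ⟨by linarith, by linarith⟩
  have e2 : round (2 * z.im) = s := round_eq_iff.mpr ⟨by linarith, by linarith⟩
  simp only [nearest, e1, e2]

/-- The direction `w / |w|` of a nonzero complex number. -/
def direction (w : ℂ) (hw : w ≠ 0) : Circle :=
  ⟨w / (‖w‖ : ℂ), by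
    rw [Submonoid.unitSphere, Submonoid.mem_mk, Subsemigroup.mem_mk, mem_sphere_zero_iff_norm, norm_div, Complex.norm_real, norm_norm,
      div_self (norm_ne_zero_iff.mpr hw)]⟩

/-- The bijection `h` from the perforated plane to the blown-up plane: with `p` the nearest lattice
point, `h z = (p + η(|z - p|) (z - p), (z - p) / |z - p|)`. If `|z - p| ≥ 1/4`, then `h z` is the
point `z` (which is not in the lattice, so that the angle does not matter). -/
def blowupMap (η : ℝ → ℝ) (z : PerforatedPlane) : BlowupPlane :=
  BlowupPlane.mk (nearest z + (η ‖(z : ℂ) - nearest z‖ : ℂ) * (z - nearest z))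
    (direction (z - nearest z) (by
      have h := z.2 (nearest z) (nearest_mem z)
      intro h0
      rw [h0, norm_zero] at h
      norm_num at h))

theorem BlowupPlane.mk_eq {ρ ρ' : ℂ} {θ θ' : Circle} :
    BlowupPlane.mk ρ θ = BlowupPlane.mk ρ' θ' ↔ ρ = ρ' ∧ (ρ ∈ halfLattice → θ = θ') :=
  Quotient.eq

theorem IsCutoff.strictMono {η : ℝ → ℝ} (hη : IsCutoff η) :
    StrictMonoOn η (Icc (1 / 8) (1 / 4)) :=
  ContinuousOn.strictMonoOn_of_injOn_Icc (by norm_num)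
    (by rw [hη.zero _ le_rfl, hη.one _ le_rfl]; norm_num) hη.smooth.continuous.continuousOn
    hη.bij.injOn

/-- `blowupMap η` is indeed a bijection. -/
theorem blowupMap_bijective {η : ℝ → ℝ} (hη : IsCutoff η) : Function.Bijective (blowupMap η) := by
  have h0 : ∀ t, 1 / 8 ≤ t → t < 1 / 4 → 0 ≤ η t ∧ η t ≤ 1 := fun t h1 h2 =>
    hη.bij.mapsTo ⟨h1, h2.le⟩
  have hnear : ∀ z : PerforatedPlane, ‖(z : ℂ) - nearest z‖ < 1 / 4 →
      nearest (nearest (z : ℂ) + (η ‖(z : ℂ) - nearest z‖ : ℂ) * (z - nearest z)) = nearest z := by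
    intro z hz
    refine nearest_eq (nearest_mem z) ?_
    obtain ⟨a, b⟩ := h0 _ (z.2 _ (nearest_mem z)) hz
    rw [add_sub_cancel_left, norm_mul, Complex.norm_real, Real.norm_of_nonneg a]
    exact (mul_le_of_le_one_left (norm_nonneg _) b).trans_lt hz
  have hfar : ∀ z : PerforatedPlane, 1 / 4 ≤ ‖(z : ℂ) - nearest z‖ →
      nearest (z : ℂ) + (η ‖(z : ℂ) - nearest z‖ : ℂ) * (z - nearest z) = z := by
    intro z hz
    rw [hη.one _ hz, Complex.ofReal_one, one_mul, add_sub_cancel]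
  constructor
  · intro z z' h
    obtain ⟨h1, h2⟩ := BlowupPlane.mk_eq.mp h
    rcases lt_or_ge ‖(z : ℂ) - nearest z‖ (1 / 4) with hz | hz <;>
      rcases lt_or_ge ‖(z' : ℂ) - nearest z'‖ (1 / 4) with hz' | hz'
    · have hp : nearest (z : ℂ) = nearest z' := by rw [← hnear z hz, h1, hnear z' hz']
      have b := z.2 _ (nearest_mem z)
      have b' := z'.2 _ (nearest_mem z')
      have hw : (η ‖(z : ℂ) - nearest z‖ : ℂ) * (z - nearest z) =
          (η ‖(z' : ℂ) - nearest z'‖ : ℂ) * (z' - nearest z') := by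
        rw [hp] at h1 ⊢
        exact add_left_cancel h1
      have hn := congrArg norm hw
      rw [norm_mul, norm_mul, Complex.norm_real, Complex.norm_real,
        Real.norm_of_nonneg (h0 _ b hz).1, Real.norm_of_nonneg (h0 _ b' hz').1] at hn
      have hr : ‖(z : ℂ) - nearest z‖ = ‖(z' : ℂ) - nearest z'‖ := by
        rcases lt_trichotomy ‖(z : ℂ) - nearest z‖ ‖(z' : ℂ) - nearest z'‖ with hlt | heq | hlt
        · have := hη.strictMono ⟨b, hz.le⟩ ⟨b', hz'.le⟩ hlt
          have p0 := (h0 _ b hz).1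
          nlinarith
        · exact heq
        · have := hη.strictMono ⟨b', hz'.le⟩ ⟨b, hz.le⟩ hlt
          have p0 := (h0 _ b' hz').1
          nlinarith
      have hd : (z : ℂ) - nearest z = z' - nearest z' := by
        by_cases he : η ‖(z' : ℂ) - nearest z'‖ = 0
        · have hm : nearest (z : ℂ) + (η ‖(z : ℂ) - nearest z‖ : ℂ) * (z - nearest z) ∈
              halfLattice := by
            rw [hr, he, Complex.ofReal_zero, zero_mul, add_zero]
            exact nearest_mem _
          have hθ := congrArg (fun θ : Circle => (θ : ℂ)) (h2 hm)
          change ((z : ℂ) - nearest z) / (‖(z : ℂ) - nearest z‖ : ℂ) =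
            ((z' : ℂ) - nearest z') / (‖(z' : ℂ) - nearest z'‖ : ℂ) at hθ
          rw [hr] at hθ
          have hne : (‖(z' : ℂ) - nearest z'‖ : ℂ) ≠ 0 := by
            rw [Complex.ofReal_ne_zero]
            linarith
          exact (div_left_inj' hne).mp hθ
        · rw [hr] at hw
          exact mul_left_cancel₀ (Complex.ofReal_ne_zero.mpr he) hw
      rw [hp] at hd
      exact Subtype.ext (sub_left_injective hd)
    · exfalso
      have e : nearest (z' : ℂ) = nearest z := by rw [← hnear z hz, h1, hfar z' hz']
      obtain ⟨a, c⟩ := h0 _ (z.2 _ (nearest_mem z)) hz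
      have e' := h1.trans (hfar z' hz')
      rw [e, ← e', add_sub_cancel_left, norm_mul, Complex.norm_real,
        Real.norm_of_nonneg a] at hz'
      nlinarith [norm_nonneg ((z : ℂ) - nearest z)]
    · exfalso
      have e : nearest (z : ℂ) = nearest z' := by rw [← hnear z' hz', ← h1, hfar z hz]
      obtain ⟨a, c⟩ := h0 _ (z'.2 _ (nearest_mem z')) hz'
      have e' := h1.symm.trans (hfar z hz)
      rw [e, ← e', add_sub_cancel_left, norm_mul, Complex.norm_real,
        Real.norm_of_nonneg a] at hz
      nlinarith [norm_nonneg ((z' : ℂ) - nearest z')]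
    · rw [hfar z hz, hfar z' hz'] at h1
      exact Subtype.ext h1
  · have key : ∀ p ∈ halfLattice, ∀ (r : ℝ) (θ : Circle), 1 / 8 ≤ r → r < 1 / 4 →
        ∃ z, blowupMap η z = BlowupPlane.mk (p + (η r : ℂ) * ((r : ℂ) * θ)) θ := by
      intro p hp r θ hr hr'
      have hn : ‖(p + (r : ℂ) * θ) - p‖ = r := by
        rw [add_sub_cancel_left, norm_mul, Complex.norm_real, Circle.norm_coe, mul_one,
          Real.norm_of_nonneg (by linarith)]
      have e : nearest (p + (r : ℂ) * θ) = p := nearest_eq hp (by rw [hn]; exact hr')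
      refine ⟨⟨p + (r : ℂ) * θ, fun q hq => ?_⟩, ?_⟩
      · by_contra hc
        push Not at hc
        have e' := nearest_eq hq (hc.trans (by norm_num))
        rw [← e', e, hn] at hc
        linarith
      · refine BlowupPlane.mk_eq.mpr ⟨?_, fun _ => Circle.ext ?_⟩
        · change nearest (p + (r : ℂ) * θ) + (η ‖(p + (r : ℂ) * θ) - nearest (p + (r : ℂ) * θ)‖ : ℂ)
            * ((p + (r : ℂ) * θ) - nearest (p + (r : ℂ) * θ)) = _
          rw [e, hn, add_sub_cancel_left]
        · change ((p + (r : ℂ) * θ) - nearest (p + (r : ℂ) * θ)) /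
            (‖(p + (r : ℂ) * θ) - nearest (p + (r : ℂ) * θ)‖ : ℂ) = θ
          have hne : (r : ℂ) ≠ 0 := by
            rw [Complex.ofReal_ne_zero]
            linarith
          rw [e, hn, add_sub_cancel_left, mul_div_cancel_left₀ _ hne]
    intro x
    obtain ⟨⟨q, θ⟩, rfl⟩ := Quotient.exists_rep x
    change ∃ z, blowupMap η z = BlowupPlane.mk q θ
    by_cases hq : q ∈ halfLattice
    · obtain ⟨z, hz⟩ := key q hq (1 / 8) θ le_rfl (by norm_num)
      refine ⟨z, hz.trans ?_⟩
      rw [hη.zero _ le_rfl, Complex.ofReal_zero, zero_mul, add_zero]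
    · have hne : q - nearest q ≠ 0 := fun h => hq (by
        rw [sub_eq_zero.mp h]
        exact nearest_mem _)
      rcases lt_or_ge ‖q - nearest q‖ (1 / 4) with hd | hd
      · have hcont : ContinuousOn (fun t : ℝ => η t * t) (Icc (1 / 8) (1 / 4)) :=
          (hη.smooth.continuous.mul continuous_id).continuousOn
        obtain ⟨r, ⟨hr1, hr2⟩, hr⟩ := intermediate_value_Ico (by norm_num) hcont
          (show ‖q - nearest q‖ ∈ Ico (η (1 / 8) * (1 / 8)) (η (1 / 4) * (1 / 4)) by
            rw [hη.zero _ le_rfl, hη.one _ le_rfl, zero_mul, one_mul]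
            exact ⟨norm_nonneg _, hd⟩)
        obtain ⟨z, hz⟩ := key _ (nearest_mem q) r (direction _ hne) hr1 hr2
        refine ⟨z, hz.trans (BlowupPlane.mk_eq.mpr ?_)⟩
        have hpt : nearest q + (η r : ℂ) * ((r : ℂ) * (direction _ hne : Circle)) = q := by
          have hr' : η r * r = ‖q - nearest q‖ := hr
          have hn0 : (‖q - nearest q‖ : ℂ) ≠ 0 :=
            Complex.ofReal_ne_zero.mpr (norm_ne_zero_iff.mpr hne)
          rw [← mul_assoc, ← Complex.ofReal_mul, hr']
          change nearest q + (‖q - nearest q‖ : ℂ) * ((q - nearest q) / (‖q - nearest q‖ : ℂ)) = q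
          rw [mul_div_cancel₀ _ hn0, add_sub_cancel]
        exact ⟨hpt, fun hm => absurd (hpt ▸ hm) hq⟩
      · refine ⟨⟨q, fun p hp => ?_⟩, BlowupPlane.mk_eq.mpr ?_⟩
        · by_contra hc
          push Not at hc
          have e := nearest_eq hp (hc.trans (by norm_num))
          rw [← e] at hc
          linarith
        · have e := hfar ⟨q, fun p hp => by
            by_contra hc
            push Not at hc
            have e := nearest_eq hp (hc.trans (by norm_num))
            rw [← e] at hc
            linarith⟩ hd
          refine ⟨e, fun hm => absurd ?_ hq⟩
          change nearest q + (η ‖q - nearest q‖ : ℂ) * (q - nearest q) = q at e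
          rwa [← e]

/-- The topology on the blown-up plane for which the bijection `blowupMap η` is a homeomorphism. -/
abbrev blowupTopology (η : ℝ → ℝ) : TopologicalSpace BlowupPlane :=
  TopologicalSpace.coinduced (blowupMap η) inferInstance

/-- Continuity in the gap topology of a family of closed subspaces of `L²` that is parametrized by a
subset `U` of the blown-up plane. -/
def IsContinuousFamily (η : ℝ → ℝ) {U : Set BlowupPlane} (F : U → Submodule ℝ L2) : Prop :=
  letI : TopologicalSpace BlowupPlane := blowupTopology η
  Continuous fun u : U => gapProj (F u)

/-- The family `𝒫^±(L)` for a family `L` of subspaces, parametrized by `U`. -/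
def apsFamily (ε : ℤˣ) {U : Set BlowupPlane} (L : U → Submodule ℝ L2) (u : U) :
    Submodule ℝ L2 :=
  apsSpace ε u.1.pt u.1.angle (L u)

end TorusAPS

end

open TorusAPS

/-!
The operator `S` for the flat connection `a_ρ` has constant coefficients: it is
`S = A(∂ₘ, ∂ₗ) - 2 A(ρ) I`, where the symbol `A(v)` (`symb`) is skew with `A(v)² = -|v|²` and
`I = ½ [i, ·]` (`fiberI`) is skew, commutes with `A(v)`, vanishes on `ℝi` and is multiplication by
`i` on `ℂj`. Hence Fourier series diagonalize it. On `ℝi`-valued forms `S` does not depend on `ρ`;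
its kernel consists of the constants, which are also the harmonic forms (`harmonicI_eq`). On the
`ℂj`-valued Fourier mode `exp (i n · x) w` (`modeForm`) it acts on `w` by `N(n - 2ρ)`, where
`N(v) = I A(v)` (`modeSymb`) is symmetric with square `|v|²`. So the positive and negative spectral
subspaces of the mode `n` only depend on the *direction* of `n - 2ρ`, and there is no contribution
exactly when `n = 2ρ`, which happens for some `n` iff `ρ ∈ (½ℤ)²`.

This is encoded in the spaces `polarization ε u`, where `u` assigns to every mode a unit vector or
zero. The spectral space `P^±_ρ` is the polarization for the directions of `n - 2ρ`
(`spectralSpace_flatConn`). Two facts make explicit computations with Fourier modes sufficient: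
`S` is symmetric on smooth forms (`integral_inner_deRhamOp`, integration by parts), and the explicit
eigenforms are total (`eq_zero_of_inner_trigL2`, Stone-Weierstrass). All orthogonality relations
follow from the symmetry: for any two modes there is a connection `a_ρ` that separates their
eigenvalues.

* The gap distance of two polarizations is at most a constant times the supremum of the distances
  of their directions (`exists_norm_gapProj_sub_le`), because the difference of the projections is
  block diagonal and linear in the directions.
* Along the ray `ρ + tθ` the direction of `n - 2(ρ + tθ)` is constantly `-θ` if `n = 2ρ`, and
  converges uniformly in the other `n`, whose frequencies are bounded away from zero. So the limit
  is the polarization for `blowDir ρ θ` (`limitSpace_eq`). For the same reason these directions are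
  equicontinuous on the perforated plane, where `n - 2ρ` is replaced by the vector from
  `z` to `n / 2`, of length at least `1 / 8`, if `z` is near `n / 2`
  (`IsCutoff.norm_perforatedDir_sub_le`).
* `J` anticommutes with `N(v)`, so it exchanges the polarizations of opposite signs with equal
  directions. If all directions are nonzero, then the orthogonal complement of `polarization ε u` is
  `polarization (-ε) u` plus the constants (`polarization_orthogonal`), so that adding a Lagrangian
  subspace of the constants gives a Lagrangian subspace (`isLagrangian_polarization_sup`).
-/

noncomputable section

namespace TorusAPS

/-! ### Linear algebra on the fibre -/

theorem su2_ext {x y : su2} (hI : (x : ℍ[ℝ]).imI = (y : ℍ[ℝ]).imI)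
    (hJ : (x : ℍ[ℝ]).imJ = (y : ℍ[ℝ]).imJ) (hK : (x : ℍ[ℝ]).imK = (y : ℍ[ℝ]).imK) : x = y :=
  Subtype.ext (Quaternion.ext _ _ (x.2.trans y.2.symm) hI hJ hK)

/-- Left multiplication by `i` on `ℂj`, extended by zero to `ℝi`; in other words `½ [i, ·]`. -/
def rotI : su2 →ₗ[ℝ] su2 where
  toFun x := ⟨⟨0, 0, -(x : ℍ[ℝ]).imK, (x : ℍ[ℝ]).imJ⟩, rfl⟩
  map_add' _ _ := su2_ext (add_zero 0).symm (neg_add _ _) rfl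
  map_smul' c _ := su2_ext (mul_zero c).symm (mul_neg _ _).symm rfl

@[simp] theorem rotI_re (x : su2) : (rotI x : ℍ[ℝ]).re = 0 := rfl

@[simp] theorem rotI_imI (x : su2) : (rotI x : ℍ[ℝ]).imI = 0 := rfl

@[simp] theorem rotI_imJ (x : su2) : (rotI x : ℍ[ℝ]).imJ = -(x : ℍ[ℝ]).imK := rfl

@[simp] theorem rotI_imK (x : su2) : (rotI x : ℍ[ℝ]).imK = (x : ℍ[ℝ]).imJ := rfl

theorem bracket_unitI (x : su2) : bracket unitI x = (2 : ℝ) • rotI x := by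
  have h0 : (unitI : ℍ[ℝ]).re = 0 := rfl
  have h1 : (unitI : ℍ[ℝ]).imI = 1 := rfl
  have h2 : (unitI : ℍ[ℝ]).imJ = 0 := rfl
  have h3 : (unitI : ℍ[ℝ]).imK = 0 := rfl
  have hb : ((bracket unitI x : su2) : ℍ[ℝ]) = (unitI : ℍ[ℝ]) * x - x * (unitI : ℍ[ℝ]) := rfl
  refine su2_ext ?_ ?_ ?_ <;>
    simp [hb, h0, h1, h2, h3, Quaternion.imI_mul, Quaternion.imJ_mul, Quaternion.imK_mul] <;> ring

theorem bracket_smul_unitI (s : ℝ) (x : su2) :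
    bracket (-(s • unitI)) x = (-(2 * s)) • rotI x := by
  have h1 : ∀ y : su2, bracket (-(s • unitI)) y = (-s) • bracket unitI y := fun y =>
    Subtype.ext (by simp [bracket, smul_sub])
  rw [h1, bracket_unitI, smul_smul]
  congr 1; ring

theorem inner_rotI (x y : su2) : inner ℝ (rotI x) y = -inner ℝ x (rotI y) := by
  simp only [Submodule.coe_inner, Quaternion.inner_def, Quaternion.re_mul, Quaternion.re_star,
    Quaternion.imI_star, Quaternion.imJ_star, Quaternion.imK_star, rotI_re, rotI_imI, rotI_imJ,
    rotI_imK]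
  ring

-- The general lemmas on scalars do not unify with the instances found on `Fiber` when rewriting.

@[simp] theorem fiber_zero_smul (w : Fiber) : (0 : ℝ) • w = 0 := zero_smul ℝ w

@[simp] theorem fiber_smul_zero (r : ℝ) : r • (0 : Fiber) = 0 := smul_zero (A := Fiber) r

@[simp] theorem fiber_neg_smul (r : ℝ) (w : Fiber) : -r • w = -(r • w) := neg_smul r w

theorem fiber_inner_smul_left (w v : Fiber) (r : ℝ) : inner ℝ (r • w) v = r * inner ℝ w v :=
  inner_smul_left (𝕜 := ℝ) (E := Fiber) w v r

theorem fiber_inner_smul_right (w v : Fiber) (r : ℝ) : inner ℝ w (r • v) = r * inner ℝ w v :=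
  inner_smul_right (𝕜 := ℝ) (E := Fiber) w v r

/-- Componentwise action of `½ [i, ·]` on the fibre. -/
def fiberI : Fiber →ₗ[ℝ] Fiber where
  toFun v := WithLp.toLp 2 fun c => rotI (v c)
  map_add' v w := by ext1 c; simp
  map_smul' r v := by ext1 c; simp

@[simp] theorem fiberI_apply (v : Fiber) (c : Fin 4) : fiberI v c = rotI (v c) := rfl

/-- The projection of the fibre onto its `ℂj`-valued part. -/
def planePart : Fiber →ₗ[ℝ] Fiber := -(fiberI ∘ₗ fiberI)

/-- The projection of the fibre onto its `ℝi`-valued part. -/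
def linePart : Fiber →ₗ[ℝ] Fiber := LinearMap.id - planePart

/-- The principal symbol of `S` in the direction `v = x + iy`, real linear in `v`: for the trivial
connection `S = symb 1 ∂ₘ + symb i ∂ₗ`. -/
def symb (v : ℂ) : Fiber →ₗ[ℝ] Fiber where
  toFun w := !₂[v.re • w 2 - v.im • w 1, v.im • w 0 - v.re • w 3,
    -(v.re • w 0) - v.im • w 3, v.re • w 1 + v.im • w 2]
  map_add' w w' := by
    refine PiLp.ext fun c => ?_
    fin_cases c <;> simp <;> abel
  map_smul' r w := by
    refine PiLp.ext fun c => ?_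
    fin_cases c <;> simp [smul_sub, smul_comm r]

theorem symb_add (v v' : ℂ) (w : Fiber) : symb (v + v') w = symb v w + symb v' w := by
  refine PiLp.ext fun c => ?_
  fin_cases c <;> simp [symb, add_smul] <;> abel

theorem symb_real_smul (r : ℝ) (v : ℂ) (w : Fiber) : symb ((r : ℂ) * v) w = r • symb v w := by
  refine PiLp.ext fun c => ?_
  fin_cases c <;> simp [symb, mul_smul, smul_sub]

theorem symb_symb (v : ℂ) (w : Fiber) : symb v (symb v w) = -(‖v‖ ^ 2 • w) := by
  rw [Complex.sq_norm, Complex.normSq_apply]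
  refine PiLp.ext fun c => ?_
  fin_cases c <;> simp [symb] <;> module

theorem fiberI_symb (v : ℂ) (w : Fiber) : fiberI (symb v w) = symb v (fiberI w) := by
  refine PiLp.ext fun c => ?_
  fin_cases c <;> simp [symb, fiberI]

theorem fiberJ_symb (v : ℂ) (w : Fiber) : fiberJ (symb v w) = -symb v (fiberJ w) := by
  refine PiLp.ext fun c => ?_
  fin_cases c <;> simp [symb, fiberJ, hodge, deg0, deg1, deg2] <;> abel

theorem fiberJ_fiberI (w : Fiber) : fiberJ (fiberI w) = fiberI (fiberJ w) := by
  refine PiLp.ext fun c => ?_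
  fin_cases c <;> simp [fiberI, fiberJ, hodge, deg0, deg1, deg2]

theorem fiberJ_fiberJ (w : Fiber) : fiberJ (fiberJ w) = -w := by
  refine PiLp.ext fun c => ?_
  fin_cases c <;> simp [fiberJ, hodge, deg0, deg1, deg2]

theorem inner_symb (v : ℂ) (w w' : Fiber) :
    inner ℝ (symb v w) w' = -inner ℝ w (symb v w') := by
  simp [PiLp.inner_apply, Fin.sum_univ_four, symb, inner_add_left, inner_add_right, inner_sub_left,
    inner_sub_right, inner_neg_left, inner_neg_right, real_inner_smul_left, real_inner_smul_right]
  ring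

theorem inner_fiberI (w w' : Fiber) : inner ℝ (fiberI w) w' = -inner ℝ w (fiberI w') := by
  simp only [PiLp.inner_apply, fiberI_apply, inner_rotI, Finset.sum_neg_distrib]

theorem fiberI_fiberI_fiberI (w : Fiber) : fiberI (fiberI (fiberI w)) = -fiberI w := by
  refine PiLp.ext fun c => su2_ext ?_ ?_ ?_ <;> simp

theorem planePart_apply (w : Fiber) : planePart w = -fiberI (fiberI w) := rfl

theorem linePart_apply (w : Fiber) : linePart w = w - planePart w := rfl

theorem fiberI_planePart (w : Fiber) : fiberI (planePart w) = fiberI w := by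
  rw [planePart_apply, map_neg, fiberI_fiberI_fiberI, neg_neg]

theorem planePart_fiberI (w : Fiber) : planePart (fiberI w) = fiberI w := by
  rw [planePart_apply, fiberI_fiberI_fiberI, neg_neg]

theorem planePart_planePart (w : Fiber) : planePart (planePart w) = planePart w := by
  rw [planePart_apply (planePart w), fiberI_planePart, planePart_apply]

theorem planePart_symb (v : ℂ) (w : Fiber) : planePart (symb v w) = symb v (planePart w) := by
  simp only [planePart_apply, fiberI_symb, map_neg]

theorem planePart_fiberJ (w : Fiber) : planePart (fiberJ w) = fiberJ (planePart w) := by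
  simp only [planePart_apply, fiberJ_fiberI, map_neg]

theorem linePart_symb (v : ℂ) (w : Fiber) : linePart (symb v w) = symb v (linePart w) := by
  simp only [linePart_apply, planePart_symb, map_sub]

theorem linePart_fiberJ (w : Fiber) : linePart (fiberJ w) = fiberJ (linePart w) := by
  simp only [linePart_apply, planePart_fiberJ, map_sub]

theorem planePart_linePart (w : Fiber) : planePart (linePart w) = 0 := by
  rw [linePart_apply, map_sub, planePart_planePart, sub_self]

theorem fiberI_linePart (w : Fiber) : fiberI (linePart w) = 0 := by
  rw [linePart_apply, map_sub, fiberI_planePart, sub_self]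

theorem planePart_add_linePart (w : Fiber) : planePart w + linePart w = w := by
  rw [linePart_apply, add_sub_cancel]

theorem planePart_mem (w : Fiber) (c : Fin 4) : planePart w c ∈ planeJ := by
  change ((planePart w c : su2) : ℍ[ℝ]).imI = 0
  simp [planePart_apply]

theorem linePart_mem (w : Fiber) (c : Fin 4) : linePart w c ∈ lineI := by
  change ((linePart w c : su2) : ℍ[ℝ]).imJ = 0 ∧ ((linePart w c : su2) : ℍ[ℝ]).imK = 0
  simp [linePart_apply, planePart_apply]

theorem planePart_eq_zero {w : Fiber} (h : ∀ c, w c ∈ lineI) : planePart w = 0 := by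
  refine PiLp.ext fun c => su2_ext ?_ ?_ ?_ <;>
    simp [planePart_apply, (h c).1, (h c).2]

/-- The symbol of `S` on `ℂj`-valued Fourier modes of frequency `v`: multiplication by `i` composed
with `symb v`. It squares to `‖v‖²` on `ℂj`-valued vectors. -/
def modeSymb (v : ℂ) : Fiber →ₗ[ℝ] Fiber := fiberI ∘ₗ symb v

theorem modeSymb_apply (v : ℂ) (w : Fiber) : modeSymb v w = fiberI (symb v w) := rfl

theorem modeSymb_modeSymb (v : ℂ) (w : Fiber) :
    modeSymb v (modeSymb v w) = ‖v‖ ^ 2 • planePart w := by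
  rw [modeSymb_apply, modeSymb_apply, ← fiberI_symb, symb_symb, planePart_apply]
  simp

theorem planePart_modeSymb (v : ℂ) (w : Fiber) : planePart (modeSymb v w) = modeSymb v w :=
  planePart_fiberI _

theorem modeSymb_planePart (v : ℂ) (w : Fiber) : modeSymb v (planePart w) = modeSymb v w := by
  rw [modeSymb_apply, ← planePart_symb, fiberI_planePart, modeSymb_apply]

theorem fiberJ_modeSymb (v : ℂ) (w : Fiber) : fiberJ (modeSymb v w) = -modeSymb v (fiberJ w) := by
  simp only [modeSymb_apply, fiberJ_fiberI, fiberJ_symb, map_neg]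

theorem modeSymb_add (v v' : ℂ) (w : Fiber) :
    modeSymb (v + v') w = modeSymb v w + modeSymb v' w := by
  simp only [modeSymb_apply, symb_add, map_add]

theorem modeSymb_real_smul (r : ℝ) (v : ℂ) (w : Fiber) :
    modeSymb ((r : ℂ) * v) w = r • modeSymb v w := by
  simp only [modeSymb_apply, symb_real_smul, map_smul]

theorem modeSymb_sub (v v' : ℂ) (w : Fiber) :
    modeSymb (v - v') w = modeSymb v w - modeSymb v' w := by
  rw [eq_sub_iff_add_eq, ← modeSymb_add, sub_add_cancel]

theorem modeSymb_zero (w : Fiber) : modeSymb 0 w = 0 := by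
  simpa using modeSymb_sub 0 0 w

/-! ### Smooth functions on the torus and integration by parts -/

/-- The pullback of a function on the torus to the universal cover `ℝ²`. -/
def lift {E : Type*} (u : Torus → E) (p : ℝ × ℝ) : E :=
  u ((p.1 : AddCircle (2 * π)), (p.2 : AddCircle (2 * π)))

/-- A function on the torus is smooth if its pullback to `ℝ²` is. -/
def IsSmoothFun {E : Type*} [NormedAddCommGroup E] [NormedSpace ℝ E] (u : Torus → E) : Prop :=
  ContDiff ℝ ∞ (lift u)

theorem continuous_of_lift {E : Type*} [TopologicalSpace E] {u : Torus → E}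
    (h : Continuous (lift u)) : Continuous u := by
  have hq : Topology.IsQuotientMap
      (Prod.map ((↑) : ℝ → AddCircle (2 * π)) ((↑) : ℝ → AddCircle (2 * π))) :=
    (QuotientAddGroup.isOpenQuotientMap_mk.prodMap
      QuotientAddGroup.isOpenQuotientMap_mk).isQuotientMap
  exact hq.continuous_iff.mpr h

section Smooth

variable {E : Type*} [NormedAddCommGroup E] [NormedSpace ℝ E] {u : Torus → E}

theorem IsSmoothFun.continuous (hu : IsSmoothFun u) : Continuous u :=
  continuous_of_lift (ContDiff.continuous hu)

theorem IsSmoothFun.hasDerivAt_fst (hu : IsSmoothFun u) (p : ℝ × ℝ) :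
    HasDerivAt (fun t : ℝ => u ((p.1 : AddCircle (2 * π)) + (t : AddCircle (2 * π)), p.2))
      (fderiv ℝ (lift u) p (1, 0)) 0 := by
  have h1 : HasFDerivAt (lift u) (fderiv ℝ (lift u) p) (p.1 + 0, p.2) := by
    simpa using (ContDiff.differentiable hu (by simp) p).hasFDerivAt
  have h2 : HasDerivAt (fun t : ℝ => (p.1 + t, p.2)) ((1 : ℝ), (0 : ℝ)) 0 :=
    ((hasDerivAt_id (0 : ℝ)).const_add p.1).prodMk (hasDerivAt_const _ _)
  have h3 := h1.comp_hasDerivAt_of_eq (0 : ℝ) h2 rfl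
  exact h3

theorem IsSmoothFun.hasDerivAt_snd (hu : IsSmoothFun u) (p : ℝ × ℝ) :
    HasDerivAt (fun t : ℝ => u (p.1, (p.2 : AddCircle (2 * π)) + (t : AddCircle (2 * π))))
      (fderiv ℝ (lift u) p (0, 1)) 0 := by
  have h1 : HasFDerivAt (lift u) (fderiv ℝ (lift u) p) (p.1, p.2 + 0) := by
    simpa using (ContDiff.differentiable hu (by simp) p).hasFDerivAt
  have h2 : HasDerivAt (fun t : ℝ => (p.1, p.2 + t)) ((0 : ℝ), (1 : ℝ)) 0 :=
    (hasDerivAt_const _ _).prodMk ((hasDerivAt_id (0 : ℝ)).const_add p.2)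
  have h3 := h1.comp_hasDerivAt_of_eq (0 : ℝ) h2 rfl
  exact h3

theorem IsSmoothFun.clm {F : Type*} [NormedAddCommGroup F] [NormedSpace ℝ F]
    (hu : IsSmoothFun u) (B : E →L[ℝ] F) : IsSmoothFun fun x => B (u x) :=
  B.contDiff.comp hu

theorem IsSmoothFun.add {v : Torus → E} (hu : IsSmoothFun u) (hv : IsSmoothFun v) :
    IsSmoothFun fun x => u x + v x := ContDiff.add hu hv

theorem IsSmoothFun.sub {v : Torus → E} (hu : IsSmoothFun u) (hv : IsSmoothFun v) :
    IsSmoothFun fun x => u x - v x := ContDiff.sub hu hv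

end Smooth

theorem exists_lift (x : Torus) :
    ∃ p : ℝ × ℝ, x = ((p.1 : AddCircle (2 * π)), (p.2 : AddCircle (2 * π))) := by
  obtain ⟨a, b⟩ := x
  obtain ⟨a, rfl⟩ := QuotientAddGroup.mk_surjective a
  obtain ⟨b, rfl⟩ := QuotientAddGroup.mk_surjective b
  exact ⟨(a, b), rfl⟩

section Partials

variable {u : Torus → su2}

theorem IsSmoothFun.lift_partialM (hu : IsSmoothFun u) :
    lift (partialM u) = fun p => fderiv ℝ (lift u) p (1, 0) :=
  funext fun p => (hu.hasDerivAt_fst p).deriv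

theorem IsSmoothFun.lift_partialL (hu : IsSmoothFun u) :
    lift (partialL u) = fun p => fderiv ℝ (lift u) p (0, 1) :=
  funext fun p => (hu.hasDerivAt_snd p).deriv

theorem IsSmoothFun.hasDerivAt_partialM (hu : IsSmoothFun u) (x : Torus) :
    HasDerivAt (fun t : ℝ => u (x.1 + (t : AddCircle (2 * π)), x.2)) (partialM u x) 0 := by
  obtain ⟨p, rfl⟩ := exists_lift x
  exact (hu.hasDerivAt_fst p).differentiableAt.hasDerivAt

theorem IsSmoothFun.hasDerivAt_partialL (hu : IsSmoothFun u) (x : Torus) :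
    HasDerivAt (fun t : ℝ => u (x.1, x.2 + (t : AddCircle (2 * π)))) (partialL u x) 0 := by
  obtain ⟨p, rfl⟩ := exists_lift x
  exact (hu.hasDerivAt_snd p).differentiableAt.hasDerivAt

theorem IsSmoothFun.partialM (hu : IsSmoothFun u) : IsSmoothFun (partialM u) := by
  unfold IsSmoothFun
  rw [hu.lift_partialM]
  exact (ContDiff.fderiv_right (m := ∞) hu (by simp)).clm_apply contDiff_const

theorem IsSmoothFun.partialL (hu : IsSmoothFun u) : IsSmoothFun (partialL u) := by
  unfold IsSmoothFun
  rw [hu.lift_partialL]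
  exact (ContDiff.fderiv_right (m := ∞) hu (by simp)).clm_apply contDiff_const

theorem IsSmoothFun.partialM_partialL (hu : IsSmoothFun u) (x : Torus) :
    TorusAPS.partialM (TorusAPS.partialL u) x = TorusAPS.partialL (TorusAPS.partialM u) x := by
  obtain ⟨p, rfl⟩ := exists_lift x
  have h1 := congrFun hu.partialL.lift_partialM p
  have h2 := congrFun hu.partialM.lift_partialL p
  have hd : DifferentiableAt ℝ (fderiv ℝ (lift u)) p :=
    (ContDiff.fderiv_right (m := ∞) hu (by simp)).differentiable (by simp) p
  have hs : IsSymmSndFDerivAt ℝ (lift u) p :=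
    (ContDiff.contDiffAt hu).isSymmSndFDerivAt (by
      rw [minSmoothness_of_isRCLikeNormedField]; exact WithTop.coe_le_coe.mpr le_top)
  rw [hu.lift_partialL, fderiv_clm_apply hd (differentiableAt_const _)] at h1
  rw [hu.lift_partialM, fderiv_clm_apply hd (differentiableAt_const _)] at h2
  simp only [fderiv_fun_const, add_apply, ContinuousLinearMap.comp_apply,
    ContinuousLinearMap.flip_apply, Pi.zero_apply, zero_apply, map_zero,
    zero_add] at h1 h2
  exact h1.trans ((hs.eq _ _).trans h2.symm)

theorem partialM_add {v : Torus → su2} (hu : IsSmoothFun u) (hv : IsSmoothFun v) (x : Torus) :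
    partialM (fun y => u y + v y) x = partialM u x + partialM v x :=
  ((hu.hasDerivAt_partialM x).add (hv.hasDerivAt_partialM x)).deriv

theorem partialM_sub {v : Torus → su2} (hu : IsSmoothFun u) (hv : IsSmoothFun v) (x : Torus) :
    partialM (fun y => u y - v y) x = partialM u x - partialM v x :=
  ((hu.hasDerivAt_partialM x).sub (hv.hasDerivAt_partialM x)).deriv

theorem partialL_add {v : Torus → su2} (hu : IsSmoothFun u) (hv : IsSmoothFun v) (x : Torus) :
    partialL (fun y => u y + v y) x = partialL u x + partialL v x :=
  ((hu.hasDerivAt_partialL x).add (hv.hasDerivAt_partialL x)).deriv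

theorem partialL_sub {v : Torus → su2} (hu : IsSmoothFun u) (hv : IsSmoothFun v) (x : Torus) :
    partialL (fun y => u y - v y) x = partialL u x - partialL v x :=
  ((hu.hasDerivAt_partialL x).sub (hv.hasDerivAt_partialL x)).deriv

theorem partialM_neg (u : Torus → su2) (x : Torus) :
    partialM (fun y => -u y) x = -partialM u x := deriv.fun_neg

theorem partialL_neg (u : Torus → su2) (x : Torus) :
    partialL (fun y => -u y) x = -partialL u x := deriv.fun_neg

theorem partialM_const (c : su2) (x : Torus) : partialM (fun _ => c) x = 0 := deriv_const _ _

theorem partialL_const (c : su2) (x : Torus) : partialL (fun _ => c) x = 0 := deriv_const _ _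

end Partials

theorem integral_eq_zero_of_hasDerivAt_fst {G G' : Torus → ℝ} (hc : Continuous G')
    (h : ∀ x : Torus, HasDerivAt (fun t : ℝ => G (x.1 + (t : AddCircle (2 * π)), x.2)) (G' x) 0) :
    ∫ x, G' x = 0 := by
  have hi : Integrable G' (volume : Measure Torus) :=
    hc.integrable_of_hasCompactSupport (HasCompactSupport.of_compactSpace _)
  rw [Measure.volume_eq_prod] at hi ⊢
  rw [integral_prod_symm _ hi]
  refine integral_eq_zero_of_ae (Eventually.of_forall fun b => ?_)
  change ∫ a : AddCircle (2 * π), G' (a, b) = 0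
  rw [← AddCircle.intervalIntegral_preimage (2 * π) 0 fun a => G' (a, b)]
  have hd : ∀ s : ℝ, HasDerivAt (fun t : ℝ => G ((t : AddCircle (2 * π)), b)) (G' (s, b)) s := by
    intro s
    have h1 := HasDerivAt.comp_sub_const s s (f := fun t : ℝ =>
      G ((s : AddCircle (2 * π)) + (t : AddCircle (2 * π)), b)) (f' := G' (s, b))
      (by rw [sub_self]; exact h (s, b))
    refine h1.congr_of_eventuallyEq (Eventually.of_forall fun t => ?_)
    simp
  rw [intervalIntegral.integral_eq_sub_of_hasDerivAt (fun s _ => hd s)]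
  · simp [AddCircle.coe_period]
  · exact (hc.comp ((AddCircle.continuous_mk' _).prodMk continuous_const)).intervalIntegrable _ _

theorem integral_eq_zero_of_hasDerivAt_snd {G G' : Torus → ℝ} (hc : Continuous G')
    (h : ∀ x : Torus, HasDerivAt (fun t : ℝ => G (x.1, x.2 + (t : AddCircle (2 * π)))) (G' x) 0) :
    ∫ x, G' x = 0 := by
  have h1 := integral_eq_zero_of_hasDerivAt_fst (G := fun x => G x.swap) (G' := fun x => G' x.swap)
    (hc.comp continuous_swap) fun x => h x.swap
  rw [Measure.volume_eq_prod] at h1 ⊢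
  rwa [integral_prod_swap] at h1

/-! ### The operator `S` in terms of its symbol, and its symmetry -/

theorem covM_flatConn (ρ : ℂ) (u : Torus → su2) (x : Torus) :
    covM (flatConn ρ) u x = partialM u x - (2 * ρ.re) • rotI (u x) := by
  rw [covM, flatConn, bracket_smul_unitI, sub_eq_add_neg]
  exact congrArg _ (Subtype.ext (neg_smul _ _))

theorem covL_flatConn (ρ : ℂ) (u : Torus → su2) (x : Torus) :
    covL (flatConn ρ) u x = partialL u x - (2 * ρ.im) • rotI (u x) := by
  rw [covL, flatConn, bracket_smul_unitI, sub_eq_add_neg]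
  exact congrArg _ (Subtype.ext (neg_smul _ _))

theorem trivialConn_eq : trivialConn = flatConn 0 := by
  simp [trivialConn, flatConn]

/-- The derivative `∂/∂m` of all components of a form. -/
def formM (φ : Form) : Form := fun x => WithLp.toLp 2 fun c => partialM (fun y => φ y c) x

/-- The derivative `∂/∂l` of all components of a form. -/
def formL (φ : Form) : Form := fun x => WithLp.toLp 2 fun c => partialL (fun y => φ y c) x

@[simp] theorem formM_apply (φ : Form) (x : Torus) (c : Fin 4) :
    formM φ x c = partialM (fun y => φ y c) x := rfl

@[simp] theorem formL_apply (φ : Form) (x : Torus) (c : Fin 4) :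
    formL φ x c = partialL (fun y => φ y c) x := rfl

theorem deRhamOp_flatConn (ρ : ℂ) (φ : Form) (x : Torus) :
    deRhamOp (flatConn ρ) φ x =
      symb 1 (formM φ x) + symb Complex.I (formL φ x) - symb (2 * ρ) (fiberI (φ x)) := by
  have hr : (2 * ρ).re = 2 * ρ.re := by simp
  have hi : (2 * ρ).im = 2 * ρ.im := by simp
  refine PiLp.ext fun c => ?_
  fin_cases c <;>
    simp [deRhamOp, hodgeForm, dA, hodge, deg0, deg1, deg2, symb, covM_flatConn, covL_flatConn,
      partialL_neg, partialM_const, partialL_const, hr, hi] <;> abel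

section

variable {φ ψ : Form}

theorem IsSmooth.isSmoothFun (hφ : IsSmooth φ) : IsSmoothFun φ := hφ

theorem IsSmooth.continuous (hφ : IsSmooth φ) : Continuous φ := hφ.isSmoothFun.continuous

theorem IsSmooth.component (hφ : IsSmooth φ) (c : Fin 4) : IsSmoothFun fun x => φ x c :=
  hφ.isSmoothFun.clm (PiLp.proj 2 (fun _ : Fin 4 => su2) c : Fiber →L[ℝ] su2)

theorem isSmooth_of_component (h : ∀ c, IsSmoothFun fun x => φ x c) : IsSmooth φ :=
  (contDiff_piLp 2).mpr h

theorem IsSmooth.formM (hφ : IsSmooth φ) : IsSmooth (formM φ) :=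
  isSmooth_of_component fun c => (hφ.component c).partialM

theorem IsSmooth.formL (hφ : IsSmooth φ) : IsSmooth (formL φ) :=
  isSmooth_of_component fun c => (hφ.component c).partialL

theorem IsSmooth.map (hφ : IsSmooth φ) (B : Fiber →ₗ[ℝ] Fiber) : IsSmooth fun x => B (φ x) :=
  hφ.isSmoothFun.clm (LinearMap.toContinuousLinearMap B)

theorem IsSmooth.deRhamOp (hφ : IsSmooth φ) (ρ : ℂ) : IsSmooth (deRhamOp (flatConn ρ) φ) := by
  rw [show TorusAPS.deRhamOp (flatConn ρ) φ = _ from funext (deRhamOp_flatConn ρ φ)]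
  have h1 : IsSmoothFun fun x => symb 1 (TorusAPS.formM φ x) := hφ.formM.map _
  have h2 : IsSmoothFun fun x => symb Complex.I (TorusAPS.formL φ x) := hφ.formL.map _
  have h3 : IsSmoothFun fun x => symb (2 * ρ) (fiberI (φ x)) := (hφ.map fiberI).map _
  exact (h1.add h2).sub h3

theorem IsSmooth.hasDerivAt_formM (hφ : IsSmooth φ) (x : Torus) :
    HasDerivAt (fun t : ℝ => φ (x.1 + (t : AddCircle (2 * π)), x.2)) (TorusAPS.formM φ x) 0 := by
  obtain ⟨p, rfl⟩ := exists_lift x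
  have h := hφ.isSmoothFun.hasDerivAt_fst p
  refine h.congr_deriv (PiLp.ext fun c => Eq.symm ?_)
  exact ((PiLp.proj 2 (fun _ : Fin 4 => su2) c : Fiber →L[ℝ] su2).hasFDerivAt.comp_hasDerivAt
    (0 : ℝ) h).deriv

theorem IsSmooth.hasDerivAt_formL (hφ : IsSmooth φ) (x : Torus) :
    HasDerivAt (fun t : ℝ => φ (x.1, x.2 + (t : AddCircle (2 * π)))) (TorusAPS.formL φ x) 0 := by
  obtain ⟨p, rfl⟩ := exists_lift x
  have h := hφ.isSmoothFun.hasDerivAt_snd p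
  refine h.congr_deriv (PiLp.ext fun c => Eq.symm ?_)
  exact ((PiLp.proj 2 (fun _ : Fin 4 => su2) c : Fiber →L[ℝ] su2).hasFDerivAt.comp_hasDerivAt
    (0 : ℝ) h).deriv

theorem integrable_inner (hφ : Continuous φ) (hψ : Continuous ψ) :
    Integrable (fun x => inner ℝ (φ x) (ψ x)) (volume : Measure Torus) :=
  (hφ.inner hψ).integrable_of_hasCompactSupport (HasCompactSupport.of_compactSpace _)

/-- Integration by parts: `S` is symmetric, since `symb v` and `½ [i, ·]` are skew and commute. -/
theorem integral_inner_deRhamOp (ρ : ℂ) (hφ : IsSmooth φ) (hψ : IsSmooth ψ) :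
    ∫ x, inner ℝ (deRhamOp (flatConn ρ) φ x) (ψ x) =
      ∫ x, inner ℝ (φ x) (deRhamOp (flatConn ρ) ψ x) := by
  have hM := integral_eq_zero_of_hasDerivAt_fst
    (G := fun x => inner ℝ (symb 1 (φ x)) (ψ x))
    (G' := fun x => inner ℝ (symb 1 (φ x)) (formM ψ x) + inner ℝ (symb 1 (formM φ x)) (ψ x))
    (((hφ.map _).continuous.inner hψ.formM.continuous).add
      ((hφ.formM.map _).continuous.inner hψ.continuous)) fun x => by
      have h := ((LinearMap.toContinuousLinearMap (symb 1)).hasFDerivAt.comp_hasDerivAt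
        (0 : ℝ) (hφ.hasDerivAt_formM x)).inner ℝ (hψ.hasDerivAt_formM x)
      simpa using h
  have hL := integral_eq_zero_of_hasDerivAt_snd
    (G := fun x => inner ℝ (symb Complex.I (φ x)) (ψ x))
    (G' := fun x => inner ℝ (symb Complex.I (φ x)) (formL ψ x) +
      inner ℝ (symb Complex.I (formL φ x)) (ψ x))
    (((hφ.map _).continuous.inner hψ.formL.continuous).add
      ((hφ.formL.map _).continuous.inner hψ.continuous)) fun x => by
      have h := ((LinearMap.toContinuousLinearMap (symb Complex.I)).hasFDerivAt.comp_hasDerivAt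
        (0 : ℝ) (hφ.hasDerivAt_formL x)).inner ℝ (hψ.hasDerivAt_formL x)
      simpa using h
  have i1 := integrable_inner (hφ.deRhamOp ρ).continuous hψ.continuous
  have i2 := integrable_inner hφ.continuous (hψ.deRhamOp ρ).continuous
  rw [← sub_eq_zero, ← integral_sub i1 i2]
  have e : ∀ x, inner ℝ (deRhamOp (flatConn ρ) φ x) (ψ x) -
      inner ℝ (φ x) (deRhamOp (flatConn ρ) ψ x) =
      (inner ℝ (symb 1 (φ x)) (formM ψ x) + inner ℝ (symb 1 (formM φ x)) (ψ x)) +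
      (inner ℝ (symb Complex.I (φ x)) (formL ψ x) +
        inner ℝ (symb Complex.I (formL φ x)) (ψ x)) := by
    intro x
    have h1 := inner_symb (2 * ρ) (fiberI (φ x)) (ψ x)
    have h2 := inner_fiberI (φ x) (symb (2 * ρ) (ψ x))
    have h3 := inner_symb 1 (φ x) (formM ψ x)
    have h4 := inner_symb Complex.I (φ x) (formL ψ x)
    rw [fiberI_symb] at h2
    simp only [deRhamOp_flatConn, inner_sub_left, inner_sub_right, inner_add_left, inner_add_right]
    linarith
  simp only [e]
  rw [integral_add, hM, hL, add_zero]
  · exact (integrable_inner (hφ.map _).continuous hψ.formM.continuous).add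
      (integrable_inner (hφ.formM.map _).continuous hψ.continuous)
  · exact (integrable_inner (hφ.map _).continuous hψ.formL.continuous).add
      (integrable_inner (hφ.formL.map _).continuous hψ.continuous)

/-- For the trivial connection `S ∘ S` is the Laplacian. -/
theorem deRhamOp_deRhamOp (hφ : IsSmooth φ) :
    deRhamOp trivialConn (deRhamOp trivialConn φ) = laplacian trivialConn φ := by
  have hM : ∀ u x, covM trivialConn u x = partialM u x := fun u x => by
    rw [trivialConn_eq, covM_flatConn]; simp
  have hL : ∀ u x, covL trivialConn u x = partialL u x := fun u x => by
    rw [trivialConn_eq, covL_flatConn]; simp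
  have hc := fun c x => (hφ.component c).partialM_partialL x
  have hm := fun c => (hφ.component c).partialM
  have hl := fun c => (hφ.component c).partialL
  have hS : deRhamOp trivialConn φ = fun x => !₂[partialM (fun y => φ y 2) x -
      partialL (fun y => φ y 1) x, partialL (fun y => φ y 0) x - partialM (fun y => φ y 3) x,
      -(partialM (fun y => φ y 0) x + partialL (fun y => φ y 3) x),
      partialM (fun y => φ y 1) x + partialL (fun y => φ y 2) x] := by
    funext x
    refine PiLp.ext fun c => ?_
    fin_cases c <;>
      simp [deRhamOp, hodgeForm, dA, hodge, deg0, deg1, deg2, hM, hL,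
        partialL_neg, partialM_const, partialL_const] <;> abel
  funext x
  refine PiLp.ext fun c => ?_
  rw [hS]
  fin_cases c <;>
    simp [deRhamOp, laplacian, dAstar, hodgeForm, dA, hodge, deg0, deg1, deg2, hM, hL,
      -neg_add_rev, partialM_neg, partialL_neg, partialM_const, partialL_const,
      partialM_add (hm _) (hl _), partialM_sub (hm _) (hl _), partialM_sub (hl _) (hm _),
      partialL_add (hm _) (hl _), partialL_sub (hm _) (hl _), partialL_sub (hl _) (hm _), hc] <;>
    abel

end

/-! ### Trigonometric forms and their density -/

/-- The phase `n₁ m + n₂ l` of the Fourier mode `n`, a well defined angle on the torus. -/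
def phase (n : ℤ × ℤ) (x : Torus) : Real.Angle := n.1 • x.1 + n.2 • x.2

/-- The frequency vector `n₁ + i n₂` of the Fourier mode `n`. -/
def freq (n : ℤ × ℤ) : ℂ := ⟨n.1, n.2⟩

theorem phase_lift (n : ℤ × ℤ) (p : ℝ × ℝ) :
    phase n ((p.1 : AddCircle (2 * π)), (p.2 : AddCircle (2 * π))) =
      ((n.1 * p.1 + n.2 * p.2 : ℝ) : Real.Angle) := by
  rw [Real.Angle.coe_add, ← zsmul_eq_mul, ← zsmul_eq_mul, Real.Angle.coe_zsmul,
    Real.Angle.coe_zsmul]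
  rfl

theorem continuous_phase (n : ℤ × ℤ) : Continuous (phase n) :=
  (continuous_fst.zsmul n.1).add (continuous_snd.zsmul n.2)

theorem phase_add (n n' : ℤ × ℤ) (x : Torus) : phase (n + n') x = phase n x + phase n' x := by
  change (n.1 + n'.1) • x.1 + (n.2 + n'.2) • x.2 = (n.1 • x.1 + n.2 • x.2) + _
  rw [add_zsmul, add_zsmul]
  exact add_add_add_comm _ _ _ _

theorem phase_neg (n : ℤ × ℤ) (x : Torus) : phase (-n) x = -phase n x := by
  change (-n.1) • x.1 + (-n.2) • x.2 = -(n.1 • x.1 + n.2 • x.2)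
  rw [neg_zsmul, neg_zsmul, neg_add]

theorem phase_zero (x : Torus) : phase 0 x = 0 := by
  change (0 : ℤ) • x.1 + (0 : ℤ) • x.2 = 0
  rw [zero_zsmul, zero_zsmul, add_zero]

/-- The trigonometric form `cos (n · x) w + sin (n · x) w'`, linear in `(w, w')`. -/
def trig (n : ℤ × ℤ) : Fiber × Fiber →ₗ[ℝ] C(Torus, Fiber) where
  toFun w := ⟨fun x => (phase n x).cos • w.1 + (phase n x).sin • w.2,
    ((Real.Angle.continuous_cos.comp (continuous_phase n)).smul continuous_const).add
      ((Real.Angle.continuous_sin.comp (continuous_phase n)).smul continuous_const)⟩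
  map_add' v w := by
    ext1 x
    simp only [Prod.fst_add, Prod.snd_add, smul_add, ContinuousMap.coe_mk, ContinuousMap.add_apply]
    abel
  map_smul' r w := by
    ext1 x
    simp [smul_comm r]

theorem trig_apply (n : ℤ × ℤ) (w : Fiber × Fiber) (x : Torus) :
    trig n w x = (phase n x).cos • w.1 + (phase n x).sin • w.2 := rfl

theorem lift_trig (n : ℤ × ℤ) (w : Fiber × Fiber) :
    lift (trig n w) = fun p => Real.cos (n.1 * p.1 + n.2 * p.2) • w.1 +
      Real.sin (n.1 * p.1 + n.2 * p.2) • w.2 := by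
  funext p
  rw [lift, trig_apply, phase_lift, Real.Angle.cos_coe, Real.Angle.sin_coe]

theorem isSmooth_trig (n : ℤ × ℤ) (w : Fiber × Fiber) : IsSmooth (trig n w) := by
  change ContDiff ℝ ∞ (lift (trig n w))
  rw [lift_trig]
  fun_prop

theorem formM_trig (n : ℤ × ℤ) (w : Fiber × Fiber) :
    formM (trig n w) = trig n ((n.1 : ℝ) • (w.2, -w.1)) := by
  funext x
  refine ((isSmooth_trig n w).hasDerivAt_formM x).unique ?_
  obtain ⟨p, rfl⟩ := exists_lift x
  have h : HasDerivAt (fun t : ℝ => (n.1 : ℝ) * (p.1 + t) + n.2 * p.2) (n.1 : ℝ) 0 := by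
    simpa using (((hasDerivAt_id (0 : ℝ)).const_add p.1).const_mul (n.1 : ℝ)).add_const (n.2 * p.2)
  have h2 := (h.cos.smul_const w.1).add (h.sin.smul_const w.2)
  convert h2 using 1
  · funext t
    exact congrFun (lift_trig n w) (p.1 + t, p.2)
  · refine (congrFun (lift_trig n _) p).trans ?_
    simp only [add_zero, Prod.smul_fst, Prod.smul_snd]
    module

theorem formL_trig (n : ℤ × ℤ) (w : Fiber × Fiber) :
    formL (trig n w) = trig n ((n.2 : ℝ) • (w.2, -w.1)) := by
  funext x
  refine ((isSmooth_trig n w).hasDerivAt_formL x).unique ?_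
  obtain ⟨p, rfl⟩ := exists_lift x
  have h : HasDerivAt (fun t : ℝ => (n.1 : ℝ) * p.1 + n.2 * (p.2 + t)) (n.2 : ℝ) 0 := by
    simpa using (((hasDerivAt_id (0 : ℝ)).const_add p.2).const_mul (n.2 : ℝ)).const_add (n.1 * p.1)
  have h2 := (h.cos.smul_const w.1).add (h.sin.smul_const w.2)
  convert h2 using 1
  · funext t
    exact congrFun (lift_trig n w) (p.1, p.2 + t)
  · refine (congrFun (lift_trig n _) p).trans ?_
    simp only [add_zero, Prod.smul_fst, Prod.smul_snd]
    module

theorem symb_freq (n : ℤ × ℤ) (w : Fiber) :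
    symb (freq n) w = (n.1 : ℝ) • symb 1 w + (n.2 : ℝ) • symb Complex.I w := by
  rw [← symb_real_smul, ← symb_real_smul, ← symb_add]
  congr 2
  apply Complex.ext <;> simp [freq]

theorem deRhamOp_trig (ρ : ℂ) (n : ℤ × ℤ) (w : Fiber × Fiber) :
    deRhamOp (flatConn ρ) (trig n w) =
      trig n (symb (freq n) w.2 - symb (2 * ρ) (fiberI w.1),
        -symb (freq n) w.1 - symb (2 * ρ) (fiberI w.2)) := by
  funext x
  rw [deRhamOp_flatConn, formM_trig, formL_trig]
  simp only [trig_apply]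
  simp only [symb_freq, map_add, map_smul, Prod.smul_fst, Prod.smul_snd, map_neg]
  module

/-- Trigonometric forms as elements of `L²`. -/
def trigL2 (n : ℤ × ℤ) : Fiber × Fiber →ₗ[ℝ] L2 :=
  (ContinuousMap.toLp 2 (volume : Measure Torus) ℝ : C(Torus, Fiber) →L[ℝ] L2).toLinearMap ∘ₗ trig n

theorem coeFn_trigL2 (n : ℤ × ℤ) (w : Fiber × Fiber) :
    trigL2 n w =ᵐ[volume] trig n w := ContinuousMap.coeFn_toLp _ _

theorem trigL2_mem_eigenforms {ρ : ℂ} {n : ℤ × ℤ} {w : Fiber × Fiber} {μ : ℝ}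
    (h1 : symb (freq n) w.2 - symb (2 * ρ) (fiberI w.1) = μ • w.1)
    (h2 : -symb (freq n) w.1 - symb (2 * ρ) (fiberI w.2) = μ • w.2) :
    trigL2 n w ∈ eigenforms (flatConn ρ) μ := by
  refine ⟨trig n w, isSmooth_trig n w, ?_, coeFn_trigL2 n w⟩
  rw [deRhamOp_trig, h1, h2, ← Prod.smul_mk, map_smul, ContinuousMap.coe_smul]

/-- The function `cos (n · x + s)` on the torus. -/
def cosPhase (n : ℤ × ℤ) (s : ℝ) : C(Torus, ℝ) :=
  ⟨fun x => (phase n x + (s : Real.Angle)).cos,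
    Real.Angle.continuous_cos.comp ((continuous_phase n).add continuous_const)⟩

theorem cosPhase_apply (n : ℤ × ℤ) (s : ℝ) (x : Torus) :
    cosPhase n s x = (phase n x).cos * Real.cos s - (phase n x).sin * Real.sin s := by
  change (phase n x + (s : Real.Angle)).cos = _
  rw [Real.Angle.cos_add, Real.Angle.cos_coe, Real.Angle.sin_coe]

theorem cosPhase_mul (n n' : ℤ × ℤ) (s s' : ℝ) :
    cosPhase n s * cosPhase n' s' =
      (1 / 2 : ℝ) • cosPhase (n + n') (s + s') + (1 / 2 : ℝ) • cosPhase (n + -n') (s + -s') := by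
  ext x
  simp only [ContinuousMap.mul_apply, ContinuousMap.add_apply, ContinuousMap.smul_apply,
    cosPhase_apply, phase_add, phase_neg, Real.Angle.cos_add, Real.Angle.sin_add,
    Real.Angle.cos_neg, Real.Angle.sin_neg, Real.cos_add, Real.sin_add, Real.cos_neg, Real.sin_neg,
    smul_eq_mul]
  ring

/-- The algebra of real trigonometric polynomials on the torus. -/
def trigAlgebra : Subalgebra ℝ C(Torus, ℝ) :=
  (Submodule.span ℝ (range fun q : (ℤ × ℤ) × ℝ => cosPhase q.1 q.2)).toSubalgebra
    (Submodule.subset_span ⟨(0, 0), by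
      ext x
      simp [cosPhase_apply, phase_zero]⟩)
    (fun f g hf hg => by
      induction hf, hg using Submodule.span_induction₂ with
      | mem_mem f g hf hg =>
        obtain ⟨p, rfl⟩ := hf
        obtain ⟨q, rfl⟩ := hg
        rw [cosPhase_mul]
        exact add_mem (Submodule.smul_mem _ _ (Submodule.subset_span ⟨(_, _), rfl⟩))
          (Submodule.smul_mem _ _ (Submodule.subset_span ⟨(_, _), rfl⟩))
      | zero_left g hg => rw [zero_mul]; exact zero_mem _
      | zero_right f hf => rw [mul_zero]; exact zero_mem _
      | add_left f g h _ _ _ h1 h2 => rw [add_mul]; exact add_mem h1 h2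
      | add_right f g h _ _ _ h1 h2 => rw [mul_add]; exact add_mem h1 h2
      | smul_left r f g _ _ h => rw [smul_mul_assoc]; exact Submodule.smul_mem _ _ h
      | smul_right r f g _ _ h => rw [mul_smul_comm]; exact Submodule.smul_mem _ _ h)

theorem trigAlgebra_dense : trigAlgebra.topologicalClosure = ⊤ := by
  refine ContinuousMap.subalgebra_topologicalClosure_eq_top_of_separatesPoints _ ?_
  have key : ∀ n : ℤ × ℤ, ∀ x y : Torus, phase n x ≠ phase n y →
      ∃ f ∈ (fun f : C(Torus, ℝ) => (f : Torus → ℝ)) '' trigAlgebra, f x ≠ f y := by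
    intro n x y h
    by_contra! hc
    have h1 := hc _ ⟨cosPhase n 0, Submodule.subset_span ⟨(n, 0), rfl⟩, rfl⟩
    have h2 := hc _ ⟨cosPhase n (π / 2), Submodule.subset_span ⟨(n, π / 2), rfl⟩, rfl⟩
    simp only [cosPhase_apply, Real.cos_zero, Real.sin_zero, Real.cos_pi_div_two,
      Real.sin_pi_div_two, mul_one, mul_zero, sub_zero, zero_sub, neg_inj] at h1 h2
    generalize phase n x = a at *
    generalize phase n y = b at *
    induction a using Real.Angle.induction_on
    induction b using Real.Angle.induction_on
    exact h (Real.Angle.cos_sin_inj h1 h2)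
  intro x y hxy
  by_cases h1 : x.1 = y.1
  · refine key (0, 1) x y fun h => hxy (Prod.ext h1 ?_)
    change (0 : ℤ) • x.1 + (1 : ℤ) • x.2 = (0 : ℤ) • y.1 + (1 : ℤ) • y.2 at h
    simpa using h
  · refine key (1, 0) x y fun h => h1 ?_
    change (1 : ℤ) • x.1 + (0 : ℤ) • x.2 = (1 : ℤ) • y.1 + (0 : ℤ) • y.2 at h
    simpa using h

/-- Multiplication of scalar functions by a fixed vector of the fibre. -/
def scalarForm (w : Fiber) : C(Torus, ℝ) →L[ℝ] C(Torus, Fiber) :=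
  ContinuousLinearMap.compLeftContinuous ℝ Torus
    (ContinuousLinearMap.toSpanSingleton ℝ w)

/-- Trigonometric forms are total in `L²`. -/
theorem eq_zero_of_inner_trigL2 {ψ : L2} (h : ∀ n w, inner ℝ ψ (trigL2 n w) = 0) : ψ = 0 := by
  let T : C(Torus, Fiber) →L[ℝ] L2 := ContinuousMap.toLp 2 (volume : Measure Torus) ℝ
  have h1 : ∀ (w : Fiber) (f : C(Torus, ℝ)), inner ℝ ψ (T (scalarForm w f)) = 0 := by
    intro w
    have hc : Continuous fun f : C(Torus, ℝ) => inner ℝ ψ (T (scalarForm w f)) :=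
      continuous_const.inner (T.continuous.comp (scalarForm w).continuous)
    have hcl : IsClosed {f : C(Torus, ℝ) | inner ℝ ψ (T (scalarForm w f)) = 0} :=
      isClosed_eq hc continuous_const
    have hsub : (trigAlgebra : Set C(Torus, ℝ)) ⊆
        {f : C(Torus, ℝ) | inner ℝ ψ (T (scalarForm w f)) = 0} := by
      intro f hf
      refine Submodule.span_induction (p := fun f _ => inner ℝ ψ (T (scalarForm w f)) = 0)
        ?_ ?_ ?_ ?_ hf
      · rintro _ ⟨⟨n, s⟩, rfl⟩
        have e : scalarForm w (cosPhase n s) = trig n (Real.cos s • w, -(Real.sin s • w)) := by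
          ext1 x
          change cosPhase n s x • w = _
          rw [cosPhase_apply, trig_apply]
          module
        change inner ℝ ψ (T (scalarForm w (cosPhase n s))) = 0
        rw [e]
        exact h n _
      · simp
      · intro f g _ _ hf hg
        rw [map_add, map_add, inner_add_right, hf, hg, add_zero]
      · intro r f _ hf
        rw [map_smul, map_smul, inner_smul_right, hf, mul_zero]
    intro f
    have hf : f ∈ trigAlgebra.topologicalClosure := by rw [trigAlgebra_dense]; trivial
    exact closure_minimal hsub hcl hf
  have h2 : ∀ g : C(Torus, Fiber), inner ℝ ψ (T g) = 0 := by
    intro g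
    let b := Module.finBasis ℝ Fiber
    have e : g = ∑ i, scalarForm (b i) ((LinearMap.toContinuousLinearMap
        (b.coord i)).compLeftContinuous ℝ Torus g) := by
      ext1 x
      rw [ContinuousMap.sum_apply]
      exact (b.sum_repr (g x)).symm
    rw [e, map_sum, inner_sum]
    exact Finset.sum_eq_zero fun i _ => h1 _ _
  have hd : DenseRange T := ContinuousMap.toLp_denseRange Fiber volume ℝ (by norm_num)
  have h3 : ∀ y, inner ℝ ψ y = 0 := fun y =>
    hd.induction_on (p := fun y => inner ℝ ψ y = 0) y
      (isClosed_eq (continuous_const.inner continuous_id) continuous_const) h2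
  exact inner_self_eq_zero.mp (h3 ψ)

/-! ### Explicit eigenforms -/

/-- Eigenforms of `S` with different eigenvalues are orthogonal. -/
theorem inner_eigenforms {ρ : ℂ} {μ μ' : ℝ} {ψ ψ' : L2} (h : ψ ∈ eigenforms (flatConn ρ) μ)
    (h' : ψ' ∈ eigenforms (flatConn ρ) μ') (hne : μ ≠ μ') : inner ℝ ψ ψ' = 0 := by
  obtain ⟨φ, hs, he, hψ⟩ := h
  obtain ⟨φ', hs', he', hψ'⟩ := h'
  have e : inner ℝ ψ ψ' = ∫ x, inner ℝ (φ x) (φ' x) := by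
    rw [L2.inner_def]
    refine integral_congr_ae ?_
    filter_upwards [hψ, hψ'] with x h1 h2
    rw [h1, h2]
  have hsym := integral_inner_deRhamOp ρ hs hs'
  rw [he, he'] at hsym
  simp only [Pi.smul_apply, fiber_inner_smul_left, fiber_inner_smul_right,
    integral_const_mul] at hsym
  rw [e]
  by_contra hc
  exact hne (mul_right_cancel₀ hc hsym)

theorem zero_mem_eigenforms (ρ : ℂ) (μ : ℝ) : (0 : L2) ∈ eigenforms (flatConn ρ) μ := by
  have h := trigL2_mem_eigenforms (ρ := ρ) (n := 0) (w := 0) (μ := μ) (by simp) (by simp)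
  rwa [map_zero] at h

/-- The unit vector in the direction of `v`; it is `0` for `v = 0`. -/
def unitVec (v : ℂ) : ℂ := v / (‖v‖ : ℂ)

theorem norm_mul_unitVec (v : ℂ) : (‖v‖ : ℂ) * unitVec v = v := by
  by_cases h : v = 0
  · simp [h]
  · exact mul_div_cancel₀ _ (Complex.ofReal_ne_zero.mpr (norm_ne_zero_iff.mpr h))

theorem norm_unitVec {v : ℂ} (h : v ≠ 0) : ‖unitVec v‖ = 1 := by
  rw [unitVec, norm_div, Complex.norm_real, norm_norm, div_self (norm_ne_zero_iff.mpr h)]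

theorem unitVec_zero : unitVec 0 = 0 := by simp [unitVec]

theorem freq_injective : Function.Injective freq := fun n n' h => by
  have h1 := congrArg Complex.re h
  have h2 := congrArg Complex.im h
  simp only [freq, Int.cast_inj] at h1 h2
  exact Prod.ext h1 h2

theorem freq_zero : freq 0 = 0 := by apply Complex.ext <;> simp [freq]

theorem freq_ne_zero {n : ℤ × ℤ} (h : n ≠ 0) : freq n ≠ 0 := fun h0 =>
  h (freq_injective (h0.trans freq_zero.symm))

/-- The sign `±1` as a real number. -/
abbrev sgn (ε : ℤˣ) : ℝ := ((ε : ℤ) : ℝ)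

theorem sgn_mul_self (ε : ℤˣ) : sgn ε * sgn ε = 1 := by
  rcases Int.units_eq_one_or ε with rfl | rfl <;> simp [sgn]

theorem sgn_neg (ε : ℤˣ) : sgn (-ε) = -sgn ε := by simp [sgn]

/-- The `ℂj`-valued Fourier mode `exp (i n · x) w`, which only depends on the `ℂj`-valued part
of `w`. -/
def modeForm (n : ℤ × ℤ) : Fiber →ₗ[ℝ] L2 := trigL2 n ∘ₗ planePart.prod fiberI

/-- The `ℝi`-valued eigenform of sign `ε`, frequency `n ≠ 0` and initial value `w`. -/
def lineForm (ε : ℤˣ) (n : ℤ × ℤ) (w : Fiber) : L2 :=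
  trigL2 n (linePart w, -(sgn ε • symb (unitVec (freq n)) (linePart w)))

/-- The constant `ℝi`-valued forms. -/
def constForm : Fiber →ₗ[ℝ] L2 := trigL2 0 ∘ₗ linePart.prod 0

theorem modeForm_apply (n : ℤ × ℤ) (w : Fiber) :
    modeForm n w = trigL2 n (planePart w, fiberI w) := rfl

theorem constForm_apply (w : Fiber) : constForm w = trigL2 0 (linePart w, 0) := rfl

theorem modeForm_planePart (n : ℤ × ℤ) (w : Fiber) : modeForm n (planePart w) = modeForm n w := by
  rw [modeForm_apply, planePart_planePart, fiberI_planePart, modeForm_apply]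

theorem symb_freq_eq (v : ℂ) (w : Fiber) : symb v w = ‖v‖ • symb (unitVec v) w := by
  rw [← symb_real_smul, norm_mul_unitVec]

theorem symb_symb_of_norm_eq_one {v : ℂ} (hv : ‖v‖ = 1) (w : Fiber) : symb v (symb v w) = -w := by
  rw [symb_symb, hv, one_pow, one_smul]

theorem lineForm_mem_eigenforms (ρ : ℂ) (ε : ℤˣ) {n : ℤ × ℤ} (hn : n ≠ 0) (w : Fiber) :
    lineForm ε n w ∈ eigenforms (flatConn ρ) (sgn ε * ‖freq n‖) := by
  have hu := norm_unitVec (freq_ne_zero hn)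
  refine trigL2_mem_eigenforms ?_ ?_
  · simp only [fiberI_linePart, map_zero, sub_zero, map_neg, map_smul, symb_freq_eq (freq n),
      symb_symb_of_norm_eq_one hu, smul_neg, neg_neg, mul_smul]
    exact smul_comm _ _ _
  · have h : fiberI (symb (unitVec (freq n)) (linePart w)) = 0 := by
      rw [fiberI_symb, fiberI_linePart, map_zero]
    simp only [map_neg, map_smul, h, fiber_smul_zero, neg_zero, map_zero, sub_zero,
      symb_freq_eq (freq n), smul_neg, smul_smul]
    rw [mul_right_comm, sgn_mul_self, one_mul]

theorem constForm_mem_eigenforms (ρ : ℂ) (w : Fiber) : constForm w ∈ eigenforms (flatConn ρ) 0 :=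
  trigL2_mem_eigenforms (by simp [fiberI_linePart])
    (by
      have h := symb_real_smul 0 0 (linePart w)
      rw [mul_zero, fiber_zero_smul] at h
      simp [freq_zero, h])

theorem modeForm_mem_eigenforms {ρ : ℂ} {n : ℤ × ℤ} {w : Fiber} {μ : ℝ}
    (h : modeSymb (freq n - 2 * ρ) w = μ • planePart w) :
    modeForm n w ∈ eigenforms (flatConn ρ) μ := by
  have hs : ∀ w, symb (freq n) w - symb (2 * ρ) w = symb (freq n - 2 * ρ) w := fun w => by
    rw [sub_eq_iff_eq_add, ← symb_add, sub_add_cancel]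
  refine trigL2_mem_eigenforms (w := (planePart w, fiberI w)) ?_ ?_
  · rw [fiberI_planePart, hs, ← fiberI_symb, ← modeSymb_apply, h]
  · have h1 : symb (2 * ρ) (fiberI (fiberI w)) = -symb (2 * ρ) (planePart w) := by
      rw [planePart_apply, map_neg, neg_neg]
    rw [h1, sub_neg_eq_add, neg_add_eq_sub, ← neg_sub, hs, ← planePart_symb, planePart_apply,
      neg_neg, ← modeSymb_apply, h, map_smul, fiberI_planePart]

theorem modeForm_mem_eigenforms_zero (n : ℤ × ℤ) (w : Fiber) :
    modeForm n w ∈ eigenforms (flatConn (freq n / 2)) 0 :=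
  modeForm_mem_eigenforms (by
    rw [mul_div_cancel₀ _ two_ne_zero, sub_self, modeSymb_zero, fiber_zero_smul])

theorem modeForm_mem_eigenforms_of_eq {ρ v : ℂ} {n : ℤ × ℤ} {r s : ℝ} {w : Fiber}
    (hr : freq n - 2 * ρ = (r : ℂ) * v) (h : modeSymb v w = s • planePart w) :
    modeForm n w ∈ eigenforms (flatConn ρ) (s * r) :=
  modeForm_mem_eigenforms (by rw [hr, modeSymb_real_smul, h, smul_smul, mul_comm])

/-- The spectral projection `½ (1 + ε N(v))` of the mode symbol `N(v)` on `ℂj`-valued vectors, for a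
unit vector `v`, extended by zero to `ℝi`-valued vectors. -/
def modeProj (ε : ℤˣ) (v : ℂ) : Fiber →ₗ[ℝ] Fiber :=
  (1 / 2 : ℝ) • (planePart + sgn ε • modeSymb v)

theorem modeProj_apply (ε : ℤˣ) (v : ℂ) (w : Fiber) :
    modeProj ε v w = (1 / 2 : ℝ) • (planePart w + sgn ε • modeSymb v w) := rfl

theorem modeSymb_modeProj (ε : ℤˣ) {v : ℂ} (hv : ‖v‖ = 1) (w : Fiber) :
    modeSymb v (modeProj ε v w) = sgn ε • planePart (modeProj ε v w) := by
  simp only [modeProj_apply, map_smul, map_add, modeSymb_planePart, modeSymb_modeSymb, hv, one_pow,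
    one_smul, planePart_planePart, planePart_modeSymb, smul_add, smul_comm (sgn ε) (1 / 2 : ℝ)]
  rw [smul_smul (sgn ε) (sgn ε), sgn_mul_self, one_smul, add_comm]

theorem modeForm_eq_add (ε : ℤˣ) (v : ℂ) (n : ℤ × ℤ) (w : Fiber) :
    modeForm n w = modeForm n (modeProj ε v w) + modeForm n (modeProj (-ε) v w) := by
  rw [← map_add, ← modeForm_planePart]
  congr 1
  rw [modeProj_apply, modeProj_apply, sgn_neg]
  module

/-! ### Orthogonality relations -/

theorem inner_lineForm_lineForm (ε : ℤˣ) {n n' : ℤ × ℤ} (hn : n ≠ 0) (hn' : n' ≠ 0)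
    (w w' : Fiber) : inner ℝ (lineForm ε n w) (lineForm (-ε) n' w') = 0 := by
  refine inner_eigenforms (lineForm_mem_eigenforms 0 ε hn w)
    (lineForm_mem_eigenforms 0 (-ε) hn' w') fun h => ?_
  have h1 := norm_pos_iff.mpr (freq_ne_zero hn)
  have h2 := norm_pos_iff.mpr (freq_ne_zero hn')
  have h3 := sgn_mul_self ε
  rw [sgn_neg] at h
  have h4 : sgn ε * sgn ε * (‖freq n‖ + ‖freq n'‖) = 0 := by linear_combination sgn ε * h
  rw [h3] at h4
  linarith

theorem sgn_ne_zero (ε : ℤˣ) : sgn ε ≠ 0 := left_ne_zero_of_mul_eq_one (sgn_mul_self ε)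

theorem inner_lineForm_constForm (ε : ℤˣ) {n : ℤ × ℤ} (hn : n ≠ 0) (w w' : Fiber) :
    inner ℝ (lineForm ε n w) (constForm w') = 0 :=
  inner_eigenforms (lineForm_mem_eigenforms 0 ε hn w) (constForm_mem_eigenforms 0 w')
    (mul_ne_zero (sgn_ne_zero ε) (norm_ne_zero_iff.mpr (freq_ne_zero hn)))

theorem inner_lineForm_modeForm (ε : ℤˣ) {n : ℤ × ℤ} (hn : n ≠ 0) (n' : ℤ × ℤ) (w w' : Fiber) :
    inner ℝ (lineForm ε n w) (modeForm n' w') = 0 :=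
  inner_eigenforms (lineForm_mem_eigenforms _ ε hn w) (modeForm_mem_eigenforms_zero n' w')
    (mul_ne_zero (sgn_ne_zero ε) (norm_ne_zero_iff.mpr (freq_ne_zero hn)))

/-- A kernel element of `S` is orthogonal to all modes `n` with nonzero eigenvalues. -/
theorem inner_modeForm_of_mem_eigenforms_zero {ρ v : ℂ} {r : ℝ} {n : ℤ × ℤ} {ψ : L2}
    (hψ : ψ ∈ eigenforms (flatConn ρ) 0) (hv : ‖v‖ = 1) (hr0 : r ≠ 0)
    (hr : freq n - 2 * ρ = (r : ℂ) * v) (w : Fiber) : inner ℝ ψ (modeForm n w) = 0 := by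
  rw [modeForm_eq_add 1 v n w, inner_add_right,
    inner_eigenforms hψ (modeForm_mem_eigenforms_of_eq hr (modeSymb_modeProj 1 hv w))
      (mul_ne_zero (sgn_ne_zero _) hr0).symm,
    inner_eigenforms hψ (modeForm_mem_eigenforms_of_eq hr (modeSymb_modeProj (-1) hv w))
      (mul_ne_zero (sgn_ne_zero _) hr0).symm, add_zero]

theorem inner_modeForm_modeForm {n n' : ℤ × ℤ} (hn : n ≠ n') (w w' : Fiber) :
    inner ℝ (modeForm n w) (modeForm n' w') = 0 := by
  have h : freq n' - freq n ≠ 0 := sub_ne_zero.mpr fun h => hn (freq_injective h.symm)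
  refine inner_modeForm_of_mem_eigenforms_zero (modeForm_mem_eigenforms_zero n w)
    (norm_unitVec h) (norm_ne_zero_iff.mpr h) ?_ w'
  rw [norm_mul_unitVec, mul_div_cancel₀ _ two_ne_zero]

theorem inner_constForm_modeForm (n : ℤ × ℤ) (w w' : Fiber) :
    inner ℝ (constForm w) (modeForm n w') = 0 :=
  -- shift the connection so that `n` has eigenvalues `±1`
  inner_modeForm_of_mem_eigenforms_zero (ρ := (freq n - 1) / 2)
    (constForm_mem_eigenforms _ w) norm_one one_ne_zero
    (by rw [mul_div_cancel₀ _ two_ne_zero]; simp) w'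

theorem inner_modeForm_modeForm_of_eigen {n : ℤ × ℤ} {v : ℂ} {s s' : ℝ} (hs : s ≠ s')
    {w w' : Fiber} (h : modeSymb v w = s • planePart w) (h' : modeSymb v w' = s' • planePart w') :
    inner ℝ (modeForm n w) (modeForm n w') = 0 := by
  -- shift the connection so that `v` is the frequency of `n`
  have hr : freq n - 2 * ((freq n - v) / 2) = ((1 : ℝ) : ℂ) * v := by
    rw [mul_div_cancel₀ _ two_ne_zero]; simp
  exact inner_eigenforms (modeForm_mem_eigenforms_of_eq hr h) (modeForm_mem_eigenforms_of_eq hr h')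
    (by simpa using hs)

/-! ### Polarizations given by a direction for every mode -/

/-- Generators of `polarization ε u`. -/
def generators (ε : ℤˣ) (u : ℤ × ℤ → ℂ) : Set L2 :=
  {ψ | ∃ n w, n ≠ 0 ∧ ψ = lineForm ε n w} ∪
    {ψ | ∃ n w, modeSymb (u n) w = sgn ε • planePart w ∧ ψ = modeForm n w}

/-- The closed span of the `ℝi`-valued eigenforms of sign `ε` and, for every mode `n`, of the
`ε`-eigenspace of the mode symbol in the direction `u n`. A mode with `u n = 0` contributes
nothing. -/
def polarization (ε : ℤˣ) (u : ℤ × ℤ → ℂ) : Submodule ℝ L2 :=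
  (Submodule.span ℝ (generators ε u)).topologicalClosure

/-- The constant `ℝi`-valued forms. -/
def constants : Submodule ℝ L2 := LinearMap.range constForm

theorem isClosed_polarization (ε : ℤˣ) (u : ℤ × ℤ → ℂ) :
    IsClosed (polarization ε u : Set L2) := Submodule.isClosed_topologicalClosure _

instance (ε : ℤˣ) (u : ℤ × ℤ → ℂ) : CompleteSpace (polarization ε u) :=
  (isClosed_polarization ε u).completeSpace_coe

instance : FiniteDimensional ℝ constants := inferInstanceAs
  (FiniteDimensional ℝ (LinearMap.range constForm))

theorem mem_orthogonal_closure_span {s : Set L2} {x : L2} (h : ∀ y ∈ s, inner ℝ y x = 0) :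
    x ∈ (Submodule.span ℝ s).topologicalClosureᗮ := by
  rw [Submodule.orthogonal_closure]
  rw [Submodule.mem_orthogonal]
  intro y hy
  induction hy using Submodule.span_induction with
  | mem y hy => exact h y hy
  | zero => exact inner_zero_left _
  | add y z _ _ h1 h2 => rw [inner_add_left, h1, h2, add_zero]
  | smul r y _ h1 => rw [real_inner_smul_left, h1, mul_zero]

theorem mem_polarization_orthogonal {ε : ℤˣ} {u : ℤ × ℤ → ℂ} {x : L2}
    (h : ∀ y ∈ generators ε u, inner ℝ y x = 0) : x ∈ (polarization ε u)ᗮ :=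
  mem_orthogonal_closure_span h

theorem lineForm_mem_polarization (ε : ℤˣ) (u : ℤ × ℤ → ℂ) {n : ℤ × ℤ} (hn : n ≠ 0) (w : Fiber) :
    lineForm ε n w ∈ polarization ε u :=
  Submodule.le_topologicalClosure _ (Submodule.subset_span (Or.inl ⟨n, w, hn, rfl⟩))

theorem modeForm_mem_polarization {ε : ℤˣ} {u : ℤ × ℤ → ℂ} {n : ℤ × ℤ} {w : Fiber}
    (h : modeSymb (u n) w = sgn ε • planePart w) : modeForm n w ∈ polarization ε u :=
  Submodule.le_topologicalClosure _ (Submodule.subset_span (Or.inr ⟨n, w, h, rfl⟩))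

theorem modeForm_eq_zero {ε : ℤˣ} {n : ℤ × ℤ} {w : Fiber}
    (h : modeSymb 0 w = sgn ε • planePart w) : modeForm n w = 0 := by
  rw [modeSymb_zero] at h
  have h1 : planePart w = 0 := (smul_eq_zero.mp h.symm).resolve_left (sgn_ne_zero ε)
  rw [← modeForm_planePart, h1, map_zero]

theorem polarization_isOrtho (ε : ℤˣ) (u : ℤ × ℤ → ℂ) :
    polarization (-ε) u ≤ (polarization ε u)ᗮ := by
  refine Submodule.topologicalClosure_minimal _ (Submodule.span_le.mpr ?_)
    (Submodule.isClosed_orthogonal _)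
  have hs : sgn ε ≠ sgn (-ε) := by
    rw [sgn_neg]
    intro h
    exact sgn_ne_zero ε (by linarith)
  rintro _ (⟨n, w, hn, rfl⟩ | ⟨n, w, hw, rfl⟩) <;> refine mem_polarization_orthogonal ?_ <;>
    rintro _ (⟨n', w', hn', rfl⟩ | ⟨n', w', hw', rfl⟩)
  · exact inner_lineForm_lineForm ε hn' hn _ _
  · rw [real_inner_comm]
    exact inner_lineForm_modeForm _ hn _ _ _
  · exact inner_lineForm_modeForm _ hn' _ _ _
  · by_cases hnn : n' = n
    · subst hnn
      exact inner_modeForm_modeForm_of_eigen hs hw' hw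
    · exact inner_modeForm_modeForm hnn _ _

theorem constants_le_orthogonal (ε : ℤˣ) (u : ℤ × ℤ → ℂ) :
    constants ≤ (polarization ε u)ᗮ := by
  rintro _ ⟨w, rfl⟩
  refine mem_polarization_orthogonal ?_
  rintro _ (⟨n', w', hn', rfl⟩ | ⟨n', w', hw', rfl⟩)
  · exact inner_lineForm_constForm ε hn' _ _
  · rw [real_inner_comm]
    exact inner_constForm_modeForm _ _ _

theorem modeForm_mem_orthogonal (ε : ℤˣ) {u : ℤ × ℤ → ℂ} {n : ℤ × ℤ} (hn : u n = 0) (w : Fiber) :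
    modeForm n w ∈ (polarization ε u)ᗮ := by
  refine mem_polarization_orthogonal ?_
  rintro _ (⟨n', w', hn', rfl⟩ | ⟨n', w', hw', rfl⟩)
  · exact inner_lineForm_modeForm _ hn' _ _ _
  · by_cases hnn : n' = n
    · subst hnn
      rw [hn] at hw'
      rw [modeForm_eq_zero hw', inner_zero_left]
    · exact inner_modeForm_modeForm hnn _ _

theorem trigL2_neg (n : ℤ × ℤ) (w w' : Fiber) : trigL2 (-n) (w, w') = trigL2 n (w, -w') := by
  have h : trig (-n) (w, w') = trig n (w, -w') := by
    ext1 x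
    simp [trig_apply, phase_neg]
  simp [trigL2, h]

theorem trigL2_zero (w w' : Fiber) : trigL2 0 (w, w') = trigL2 0 (w, 0) := by
  have h : trig 0 (w, w') = trig 0 (w, 0) := by
    ext1 x
    simp [trig_apply, phase_zero]
  simp [trigL2, h]

theorem trigL2_eq (n : ℤ × ℤ) (w w' : Fiber) : trigL2 n (w, w') =
    (1 / 2 : ℝ) • (modeForm n (w - fiberI w') + modeForm (-n) (w + fiberI w')) +
      trigL2 n (linePart w, linePart w') := by
  simp only [modeForm_apply, trigL2_neg]
  have hw := planePart_add_linePart w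
  have hw' := planePart_add_linePart w'
  have hI : fiberI (fiberI w') = -planePart w' := by rw [planePart_apply, neg_neg]
  rw [← map_add, ← map_smul, ← map_add]
  congr 1
  refine Prod.ext ?_ ?_
  · simp only [Prod.mk_add_mk, Prod.smul_mk, map_sub, map_add, planePart_fiberI]
    nth_rewrite 1 [← hw]
    module
  · simp only [Prod.mk_add_mk, Prod.smul_mk, map_sub, map_add, hI]
    nth_rewrite 1 [← hw']
    module

theorem trigL2_linePart_eq (ε : ℤˣ) {n : ℤ × ℤ} (hn : n ≠ 0) (w w' : Fiber) :
    trigL2 n (linePart w, linePart w') =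
      (1 / 2 : ℝ) • (lineForm ε n (w + sgn ε • symb (unitVec (freq n)) w') +
        lineForm (-ε) n (w - sgn ε • symb (unitVec (freq n)) w')) := by
  have hu := norm_unitVec (freq_ne_zero hn)
  simp only [lineForm, sgn_neg]
  rw [← map_add, ← map_smul]
  congr 1
  refine Prod.ext ?_ ?_ <;>
    simp only [Prod.mk_add_mk, Prod.smul_mk, map_add, map_sub, map_smul, linePart_symb,
      symb_symb_of_norm_eq_one hu, smul_add, smul_sub, smul_smul, sgn_mul_self, smul_neg,
      neg_mul, neg_smul, one_smul]
  · module
  · module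

/-- The `ε` and `-ε` polarizations, the constants and the modes without direction are total. -/
theorem eq_zero_of_orthogonal {ε : ℤˣ} {u : ℤ × ℤ → ℂ} (hu : ∀ n, u n ≠ 0 → ‖u n‖ = 1) {x : L2}
    (h1 : x ∈ (polarization ε u)ᗮ) (h2 : x ∈ (polarization (-ε) u)ᗮ) (h3 : x ∈ constantsᗮ)
    (h4 : ∀ n w, u n = 0 → inner ℝ (modeForm n w) x = 0) : x = 0 := by
  have hm : ∀ n w, inner ℝ (modeForm n w) x = 0 := by
    intro n w
    by_cases hn : u n = 0
    · exact h4 n w hn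
    · rw [modeForm_eq_add ε (u n) n w, inner_add_left,
        h1 _ (modeForm_mem_polarization (modeSymb_modeProj ε (hu n hn) w)),
        h2 _ (modeForm_mem_polarization (modeSymb_modeProj (-ε) (hu n hn) w)), add_zero]
  refine eq_zero_of_inner_trigL2 ?_
  rintro n ⟨w, w'⟩
  rw [real_inner_comm, trigL2_eq, inner_add_left, real_inner_smul_left, inner_add_left, hm, hm]
  by_cases hn : n = 0
  · subst hn
    rw [trigL2_zero, ← constForm_apply, h3 _ ⟨w, rfl⟩]
    simp
  · rw [trigL2_linePart_eq ε hn, real_inner_smul_left, inner_add_left,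
      h1 _ (lineForm_mem_polarization ε u hn _), h2 _ (lineForm_mem_polarization (-ε) u hn _)]
    simp

/-- The directions of the frequencies `n - 2ρ` of the modes with respect to `a_ρ`. -/
def connDir (ρ : ℂ) (n : ℤ × ℤ) : ℂ := unitVec (freq n - 2 * ρ)

theorem connDir_eq_zero {ρ : ℂ} {n : ℤ × ℤ} : connDir ρ n = 0 ↔ freq n = 2 * ρ := by
  refine ⟨fun h => ?_, fun h => ?_⟩
  · by_contra hc
    have := norm_unitVec (sub_ne_zero.mpr hc)
    rw [connDir] at h
    rw [h, norm_zero] at this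
    exact zero_ne_one this
  · rw [connDir, h, sub_self, unitVec_zero]

theorem norm_connDir {ρ : ℂ} {n : ℤ × ℤ} (h : connDir ρ n ≠ 0) : ‖connDir ρ n‖ = 1 :=
  norm_unitVec (sub_ne_zero.mpr (mt connDir_eq_zero.mpr h))

theorem generators_connDir_eigen (ε : ℤˣ) (ρ : ℂ) {ψ : L2} (h : ψ ∈ generators ε (connDir ρ)) :
    ∃ μ : ℝ, 0 < sgn ε * μ ∧ ψ ∈ eigenforms (flatConn ρ) μ := by
  rcases h with ⟨n, w, hn, rfl⟩ | ⟨n, w, hw, rfl⟩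
  · refine ⟨_, ?_, lineForm_mem_eigenforms ρ ε hn w⟩
    rw [← mul_assoc, sgn_mul_self, one_mul]
    exact norm_pos_iff.mpr (freq_ne_zero hn)
  · by_cases h0 : connDir ρ n = 0
    · rw [h0] at hw
      rw [modeForm_eq_zero hw]
      exact ⟨sgn ε, by rw [sgn_mul_self]; exact one_pos, zero_mem_eigenforms _ _⟩
    · refine ⟨_, ?_, modeForm_mem_eigenforms_of_eq (norm_mul_unitVec _).symm hw⟩
      rw [← mul_assoc, sgn_mul_self, one_mul]
      exact norm_pos_iff.mpr (sub_ne_zero.mpr (mt connDir_eq_zero.mpr h0))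

/-- The spectral subspaces of `S` are polarizations: an eigenform with eigenvalue of sign `ε` is
orthogonal to the other explicit eigenforms, which are total together with the generators. -/
theorem spectralSpace_flatConn (ε : ℤˣ) (ρ : ℂ) :
    spectralSpace ε (flatConn ρ) = polarization ε (connDir ρ) := by
  refine le_antisymm ?_ (Submodule.topologicalClosure_mono (Submodule.span_mono fun ψ h =>
    generators_connDir_eigen ε ρ h))
  refine Submodule.topologicalClosure_minimal _ (Submodule.span_le.mpr ?_)
    (isClosed_polarization _ _)
  rintro ψ ⟨μ, hμ, hψ⟩
  have hμ0 : μ ≠ 0 := right_ne_zero_of_mul hμ.ne'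
  set p : L2 := (polarization ε (connDir ρ)).starProjection ψ
  have hp : p ∈ polarization ε (connDir ρ) := Submodule.starProjection_apply_mem _ _
  have key : ψ - p = 0 := by
    refine eq_zero_of_orthogonal (ε := ε) (u := connDir ρ) (fun n => norm_connDir)
      (Submodule.sub_starProjection_mem_orthogonal _) (sub_mem ?_ ?_) (sub_mem ?_ ?_) ?_
    · refine mem_polarization_orthogonal fun y hy => ?_
      obtain ⟨μ', hμ', hy'⟩ := generators_connDir_eigen _ ρ hy
      refine inner_eigenforms hy' hψ fun h => ?_
      rw [h, sgn_neg] at hμ'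
      linarith
    · have h := polarization_isOrtho (-ε) (connDir ρ)
      rw [neg_neg] at h
      exact h hp
    · rw [Submodule.mem_orthogonal]
      rintro _ ⟨w, rfl⟩
      exact inner_eigenforms (constForm_mem_eigenforms ρ w) hψ hμ0.symm
    · rw [Submodule.mem_orthogonal]
      intro y hy
      rw [real_inner_comm]
      exact constants_le_orthogonal _ _ hy _ hp
    · intro n w hn
      rw [inner_sub_right, real_inner_comm p, modeForm_mem_orthogonal ε hn w _ hp, sub_zero]
      refine inner_eigenforms (μ := 0) (modeForm_mem_eigenforms ?_) hψ hμ0.symm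
      rw [connDir_eq_zero.mp hn, sub_self, modeSymb_zero, fiber_zero_smul]
  rw [SetLike.mem_coe, sub_eq_zero.mp key]
  exact hp

/-! ### Fibrewise operators and projections onto polarizations -/

/-- The operator on `L²` that applies an endomorphism of the fibre pointwise. -/
def fiberwise (B : Fiber →ₗ[ℝ] Fiber) : L2 →L[ℝ] L2 :=
  ContinuousLinearMap.compLpL 2 volume (LinearMap.toContinuousLinearMap B)

theorem coeFn_fiberwise (B : Fiber →ₗ[ℝ] Fiber) (ψ : L2) :
    fiberwise B ψ =ᵐ[volume] fun x => B (ψ x) :=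
  ContinuousLinearMap.coeFn_compLpL _ _

theorem fiberwise_trigL2 (B : Fiber →ₗ[ℝ] Fiber) (n : ℤ × ℤ) (w : Fiber × Fiber) :
    fiberwise B (trigL2 n w) = trigL2 n (B w.1, B w.2) := by
  refine Lp.ext ?_
  filter_upwards [coeFn_fiberwise B (trigL2 n w), coeFn_trigL2 n w,
    coeFn_trigL2 n (B w.1, B w.2)] with x h1 h2 h3
  rw [h1, h2, h3, trig_apply, trig_apply, map_add, map_smul, map_smul]

theorem fiberwise_modeForm {B : Fiber →ₗ[ℝ] Fiber} (hB : ∀ w, B (fiberI w) = fiberI (B w))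
    (n : ℤ × ℤ) (w : Fiber) : fiberwise B (modeForm n w) = modeForm n (B w) := by
  rw [modeForm_apply, fiberwise_trigL2, modeForm_apply]
  simp only [planePart_apply, map_neg, hB]

/-- `modeSymb v` is linear in `v`, so its size is controlled by its values at `1` and `i`. -/
theorem exists_norm_modeForm_modeSymb_le : ∃ C : ℝ, 0 ≤ C ∧ ∀ (n : ℤ × ℤ) (v : ℂ) (w : Fiber),
    ‖modeForm n (modeSymb v w)‖ ≤ C * ‖v‖ * ‖modeForm n w‖ := by
  refine ⟨‖fiberwise (modeSymb 1)‖ + ‖fiberwise (modeSymb Complex.I)‖, by positivity, ?_⟩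
  intro n v w
  have hB : ∀ v w, modeSymb v (fiberI w) = fiberI (modeSymb v w) := fun v w => by
    rw [modeSymb_apply, modeSymb_apply, fiberI_symb, fiberI_symb, fiberI_symb]
  have e : modeSymb v w = v.re • modeSymb 1 w + v.im • modeSymb Complex.I w := by
    rw [← modeSymb_real_smul, ← modeSymb_real_smul, ← modeSymb_add, mul_one, Complex.re_add_im]
  rw [e, map_add, map_smul, map_smul, ← fiberwise_modeForm (hB _), ← fiberwise_modeForm (hB _)]
  refine (norm_add_le _ _).trans ?_
  rw [norm_smul, norm_smul, Real.norm_eq_abs, Real.norm_eq_abs, add_mul, add_mul]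
  have h1 := (fiberwise (modeSymb 1)).le_opNorm (modeForm n w)
  have h2 := (fiberwise (modeSymb Complex.I)).le_opNorm (modeForm n w)
  have h3 := Complex.abs_re_le_norm v
  have h4 := Complex.abs_im_le_norm v
  refine add_le_add ?_ ?_
  · calc _ ≤ ‖v‖ * (‖fiberwise (modeSymb 1)‖ * ‖modeForm n w‖) := by gcongr
      _ = _ := by ring
  · calc _ ≤ ‖v‖ * (‖fiberwise (modeSymb Complex.I)‖ * ‖modeForm n w‖) := by gcongr
      _ = _ := by ring

theorem gapProj_eq {V : Submodule ℝ L2} {x p : L2} (hp : p ∈ V) (h : x - p ∈ Vᗮ) :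
    gapProj V x = p := by
  refine Submodule.eq_starProjection_of_mem_orthogonal (Submodule.le_topologicalClosure _ hp) ?_
  rwa [Submodule.orthogonal_closure]

theorem gapProj_of_mem {V : Submodule ℝ L2} {x : L2} (h : x ∈ V) : gapProj V x = x :=
  gapProj_eq h (by rw [sub_self]; exact zero_mem _)

theorem gapProj_of_mem_orthogonal {V : Submodule ℝ L2} {x : L2} (h : x ∈ Vᗮ) : gapProj V x = 0 :=
  gapProj_eq (zero_mem _) (by rwa [sub_zero])

theorem gapProj_mem {V : Submodule ℝ L2} (x : L2) : gapProj V x ∈ V.topologicalClosure :=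
  Submodule.starProjection_apply_mem _ _

theorem sub_gapProj_mem (V : Submodule ℝ L2) (x : L2) : x - gapProj V x ∈ Vᗮ := by
  rw [← Submodule.orthogonal_closure]
  exact Submodule.sub_starProjection_mem_orthogonal _

/-- The projection onto a sum of orthogonal subspaces, which need not be closed. -/
theorem gapProj_sup {V W : Submodule ℝ L2} (h : W ≤ Vᗮ) :
    gapProj (V ⊔ W) = gapProj V + gapProj W := by
  ext1 x
  have h' : V ≤ Wᗮ := fun v hv => by
    rw [Submodule.mem_orthogonal]
    intro w hw
    rw [real_inner_comm]
    exact h hw v hv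
  have hW : W.topologicalClosure ≤ Vᗮ :=
    Submodule.topologicalClosure_minimal _ h (Submodule.isClosed_orthogonal _)
  have hV : V.topologicalClosure ≤ Wᗮ :=
    Submodule.topologicalClosure_minimal _ h' (Submodule.isClosed_orthogonal _)
  refine Submodule.eq_starProjection_of_mem_orthogonal (add_mem ?_ ?_) ?_
  · exact Submodule.topologicalClosure_mono le_sup_left (gapProj_mem x)
  · exact Submodule.topologicalClosure_mono le_sup_right (gapProj_mem x)
  · rw [Submodule.orthogonal_closure, ← Submodule.inf_orthogonal]
    refine ⟨?_, ?_⟩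
    · rw [add_apply, ← sub_sub]
      exact sub_mem (sub_gapProj_mem V x) (hW (gapProj_mem x))
    · rw [add_apply, add_comm, ← sub_sub]
      exact sub_mem (sub_gapProj_mem W x) (hV (gapProj_mem x))

theorem gapProj_polarization_modeForm (ε : ℤˣ) {u : ℤ × ℤ → ℂ} {n : ℤ × ℤ} (hu : ‖u n‖ = 1)
    (w : Fiber) : gapProj (polarization ε u) (modeForm n w) = modeForm n (modeProj ε (u n) w) := by
  refine gapProj_eq (modeForm_mem_polarization (modeSymb_modeProj ε hu w)) ?_
  rw [modeForm_eq_add ε (u n) n w, add_sub_cancel_left]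
  exact polarization_isOrtho ε u (modeForm_mem_polarization (modeSymb_modeProj (-ε) hu w))

/-- Mutually orthogonal blocks preserved by the projections onto all polarizations of sign `ε`:
the `ℝi`-valued trigonometric forms, and the `ℂj`-valued Fourier modes. -/
def block (ε : ℤˣ) : Option (ℤ × ℤ) → Submodule ℝ L2
  | none => Submodule.span ℝ ({ψ | ∃ n w, n ≠ 0 ∧ ψ = lineForm ε n w} ∪
      {ψ | ∃ n w, n ≠ 0 ∧ ψ = lineForm (-ε) n w}) ⊔ constants
  | some n => LinearMap.range (modeForm n)

theorem block_none_isOrtho (ε : ℤˣ) (n : ℤ × ℤ) : block ε none ⟂ block ε (some n) := by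
  refine sup_le (Submodule.span_le.mpr ?_) ?_
  · rintro _ (⟨n', w', hn', rfl⟩ | ⟨n', w', hn', rfl⟩) _ ⟨w, rfl⟩ <;> rw [real_inner_comm]
    · exact inner_lineForm_modeForm _ hn' _ _ _
    · exact inner_lineForm_modeForm _ hn' _ _ _
  · rintro _ ⟨w, rfl⟩ _ ⟨w', rfl⟩
    rw [real_inner_comm]
    exact inner_constForm_modeForm _ _ _

theorem orthogonalFamily_block (ε : ℤˣ) :
    OrthogonalFamily ℝ (fun i => block ε i) fun i => (block ε i).subtypeₗᵢ := by
  refine OrthogonalFamily.of_pairwise fun i j hij => ?_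
  match i, j with
  | none, none => exact absurd rfl hij
  | none, some n => exact block_none_isOrtho ε n
  | some n, none => exact (block_none_isOrtho ε n).symm
  | some n, some n' =>
    rw [Function.onFun, Submodule.isOrtho_iff_inner_eq]
    rintro _ ⟨w, rfl⟩ _ ⟨w', rfl⟩
    exact inner_modeForm_modeForm (fun h => hij (congrArg some h)) _ _

theorem block_dense (ε : ℤˣ) : (⨆ i, block ε i).topologicalClosure = ⊤ := by
  rw [Submodule.topologicalClosure_eq_top_iff, Submodule.eq_bot_iff]
  intro x hx
  have h1 : ∀ i, ∀ y ∈ block ε i, inner ℝ y x = 0 := fun i y hy => hx _ (le_iSup (block ε) i hy)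
  have hl : ∀ n w, n ≠ 0 → inner ℝ (lineForm ε n w) x = 0 := fun n w hn =>
    h1 none _ (Submodule.mem_sup_left (Submodule.subset_span (Or.inl ⟨n, w, hn, rfl⟩)))
  have hl' : ∀ n w, n ≠ 0 → inner ℝ (lineForm (-ε) n w) x = 0 := fun n w hn =>
    h1 none _ (Submodule.mem_sup_left (Submodule.subset_span (Or.inr ⟨n, w, hn, rfl⟩)))
  have hm : ∀ n w, inner ℝ (modeForm n w) x = 0 := fun n w => h1 (some n) _ ⟨w, rfl⟩
  refine eq_zero_of_orthogonal (ε := ε) (u := 0) (fun n h => absurd rfl h)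
    (mem_polarization_orthogonal ?_) (mem_polarization_orthogonal ?_) ?_ fun n w _ => hm n w
  · rintro _ (⟨n', w', hn', rfl⟩ | ⟨n', w', -, rfl⟩)
    exacts [hl _ _ hn', hm _ _]
  · rintro _ (⟨n', w', hn', rfl⟩ | ⟨n', w', -, rfl⟩)
    exacts [hl' _ _ hn', hm _ _]
  · exact fun y hy => h1 none y (Submodule.mem_sup_right hy)

/-- A block diagonal operator is bounded by the supremum of the norms of its blocks. -/
theorem norm_le_of_orthogonalFamily {ι E : Type*} [NormedAddCommGroup E] [InnerProductSpace ℝ E]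
    {V : ι → Submodule ℝ E} (hV : OrthogonalFamily ℝ (fun i => V i) fun i => (V i).subtypeₗᵢ)
    (hd : (⨆ i, V i).topologicalClosure = ⊤) (D : E →L[ℝ] E) {c : ℝ} (hc : 0 ≤ c)
    (hD : ∀ i, ∀ v ∈ V i, D v ∈ V i ∧ ‖D v‖ ≤ c * ‖v‖) : ‖D‖ ≤ c := by
  refine D.opNorm_le_bound hc fun x => ?_
  have hcl : IsClosed {x : E | ‖D x‖ ≤ c * ‖x‖} :=
    isClosed_le D.continuous.norm (continuous_const.mul continuous_norm)
  have hx : x ∈ (⨆ i, V i).topologicalClosure := by rw [hd]; trivial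
  refine closure_minimal (fun y hy => ?_) hcl hx
  obtain ⟨f, hf, rfl⟩ := (Submodule.mem_iSup_iff_exists_finsupp _ _).mp hy
  have h1 := hV.norm_sum (fun i => ⟨f i, hf i⟩) f.support
  have h2 := hV.norm_sum (fun i => ⟨D (f i), (hD i _ (hf i)).1⟩) f.support
  simp only [Submodule.coe_subtypeₗᵢ, Submodule.subtype_apply, Submodule.coe_norm] at h1 h2
  change ‖D (f.sum fun _ x => x)‖ ≤ c * ‖f.sum fun _ x => x‖
  rw [Finsupp.sum, map_sum]
  refine (sq_le_sq₀ (norm_nonneg _) (by positivity)).mp ?_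
  rw [h2, mul_pow, h1, Finset.mul_sum]
  refine Finset.sum_le_sum fun i _ => ?_
  rw [← mul_pow]
  exact pow_le_pow_left₀ (norm_nonneg _) (hD i _ (hf i)).2 2

/-- The gap distance of two polarizations is controlled by the largest distance between their
directions. -/
theorem exists_norm_gapProj_sub_le (ε : ℤˣ) : ∃ C : ℝ, 0 ≤ C ∧ ∀ (u u' : ℤ × ℤ → ℂ) (c : ℝ),
    0 ≤ c → (∀ n, ‖u n‖ = 1) → (∀ n, ‖u' n‖ = 1) → (∀ n, ‖u n - u' n‖ ≤ c) →
    ‖gapProj (polarization ε u) - gapProj (polarization ε u')‖ ≤ C * c := by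
  obtain ⟨C, hC, h⟩ := exists_norm_modeForm_modeSymb_le
  refine ⟨C, hC, fun u u' c hc hu hu' huu => ?_⟩
  refine norm_le_of_orthogonalFamily (orthogonalFamily_block ε) (block_dense ε) _ (by positivity)
    fun i v hv => ?_
  match i with
  | none =>
    have h0 : (gapProj (polarization ε u) - gapProj (polarization ε u')) v = 0 := by
      have hle : block ε none ≤ LinearMap.ker
          (gapProj (polarization ε u) - gapProj (polarization ε u')).toLinearMap := by
        refine sup_le (Submodule.span_le.mpr ?_) fun y hy => ?_
        · rintro _ (⟨n, w, hn, rfl⟩ | ⟨n, w, hn, rfl⟩)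
          · change gapProj (polarization ε u) (lineForm ε n w) -
              gapProj (polarization ε u') (lineForm ε n w) = 0
            rw [gapProj_of_mem (lineForm_mem_polarization ε u hn w),
              gapProj_of_mem (lineForm_mem_polarization ε u' hn w), sub_self]
          · change gapProj (polarization ε u) (lineForm (-ε) n w) -
              gapProj (polarization ε u') (lineForm (-ε) n w) = 0
            rw [gapProj_of_mem_orthogonal
                (polarization_isOrtho ε u (lineForm_mem_polarization (-ε) u hn w)),
              gapProj_of_mem_orthogonal
                (polarization_isOrtho ε u' (lineForm_mem_polarization (-ε) u' hn w)), sub_self]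
        · change gapProj (polarization ε u) y - gapProj (polarization ε u') y = 0
          rw [gapProj_of_mem_orthogonal (constants_le_orthogonal ε u hy),
            gapProj_of_mem_orthogonal (constants_le_orthogonal ε u' hy), sub_self]
      exact hle hv
    rw [h0, norm_zero]
    exact ⟨zero_mem _, by positivity⟩
  | some n =>
    obtain ⟨w, rfl⟩ := hv
    have e : (gapProj (polarization ε u) - gapProj (polarization ε u')) (modeForm n w) =
        ((1 / 2 : ℝ) * sgn ε) • modeForm n (modeSymb (u n - u' n) w) := by
      change gapProj (polarization ε u) (modeForm n w) -
        gapProj (polarization ε u') (modeForm n w) = _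
      rw [gapProj_polarization_modeForm ε (hu n), gapProj_polarization_modeForm ε (hu' n),
        ← map_sub, ← map_smul, modeProj_apply, modeProj_apply, modeSymb_sub]
      congr 1
      module
    have hs : |sgn ε| = 1 := by
      rcases Int.units_eq_one_or ε with rfl | rfl <;> simp [sgn]
    rw [e]
    refine ⟨Submodule.smul_mem _ _ ⟨_, rfl⟩, ?_⟩
    rw [norm_smul, norm_mul, Real.norm_eq_abs (sgn ε), hs]
    have h1 := h n (u n - u' n) w
    have h2 : C * ‖u n - u' n‖ * ‖modeForm n w‖ ≤ C * c * ‖modeForm n w‖ := by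
      gcongr
      exact huu n
    have h3 := norm_nonneg (modeForm n (modeSymb (u n - u' n) w))
    norm_num
    linarith

/-! ### The complex structure and Lagrangian subspaces -/

theorem J_eq : J = fiberwise fiberJ := rfl

theorem J_J (ψ : L2) : J (J ψ) = -ψ := by
  refine Lp.ext ?_
  filter_upwards [coeFn_fiberwise fiberJ ψ, coeFn_fiberwise fiberJ (fiberwise fiberJ ψ),
    Lp.coeFn_neg ψ] with x h1 h2 h3
  rw [J_eq, h2, h1, h3, fiberJ_fiberJ, Pi.neg_apply]

theorem J_modeForm (n : ℤ × ℤ) (w : Fiber) : J (modeForm n w) = modeForm n (fiberJ w) :=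
  fiberwise_modeForm fiberJ_fiberI n w

theorem J_lineForm (ε : ℤˣ) (n : ℤ × ℤ) (w : Fiber) :
    J (lineForm ε n w) = lineForm (-ε) n (fiberJ w) := by
  rw [J_eq, lineForm, fiberwise_trigL2, lineForm, sgn_neg]
  congr 2
  · exact (linePart_fiberJ w).symm
  · simp only [map_neg, map_smul, fiberJ_symb, linePart_fiberJ, smul_neg, fiber_neg_smul]

theorem J_polarization_le (ε : ℤˣ) (u : ℤ × ℤ → ℂ) :
    polarization ε u ≤ (polarization (-ε) u).comap (J : L2 →ₗ[ℝ] L2) := by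
  refine Submodule.topologicalClosure_minimal _ (Submodule.span_le.mpr ?_)
    ((isClosed_polarization _ _).preimage J.continuous)
  rintro _ (⟨n, w, hn, rfl⟩ | ⟨n, w, hw, rfl⟩)
  · change J (lineForm ε n w) ∈ polarization (-ε) u
    rw [J_lineForm]
    exact lineForm_mem_polarization _ _ hn _
  · change J (modeForm n w) ∈ polarization (-ε) u
    rw [J_modeForm]
    refine modeForm_mem_polarization ?_
    rw [← neg_eq_iff_eq_neg.mpr (fiberJ_modeSymb (u n) w), hw, map_smul, sgn_neg, fiber_neg_smul,
      planePart_fiberJ]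

theorem map_J_polarization (ε : ℤˣ) (u : ℤ × ℤ → ℂ) :
    (polarization ε u).map (J : L2 →ₗ[ℝ] L2) = polarization (-ε) u := by
  refine le_antisymm (Submodule.map_le_iff_le_comap.mpr (J_polarization_le ε u)) fun x hx => ?_
  have h := J_polarization_le (-ε) u hx
  rw [neg_neg] at h
  refine ⟨-J x, neg_mem h, ?_⟩
  change J (-J x) = x
  rw [map_neg, J_J, neg_neg]

theorem polarization_orthogonal (ε : ℤˣ) {u : ℤ × ℤ → ℂ} (hu : ∀ n, ‖u n‖ = 1) :
    (polarization ε u)ᗮ = polarization (-ε) u ⊔ constants := by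
  refine le_antisymm (fun x hx => ?_)
    (sup_le (polarization_isOrtho ε u) (constants_le_orthogonal ε u))
  set a : L2 := (polarization (-ε) u).starProjection x
  set b : L2 := constants.starProjection x
  have ha : a ∈ polarization (-ε) u := Submodule.starProjection_apply_mem _ _
  have hb : b ∈ constants := Submodule.starProjection_apply_mem _ _
  have key : x - a - b = 0 := by
    refine eq_zero_of_orthogonal (ε := ε) (fun n _ => hu n) ?_ ?_ ?_ fun n w h => ?_
    · exact sub_mem (sub_mem hx (polarization_isOrtho ε u ha)) (constants_le_orthogonal ε u hb)
    · exact sub_mem (Submodule.sub_starProjection_mem_orthogonal _)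
        (constants_le_orthogonal (-ε) u hb)
    · rw [sub_right_comm]
      refine sub_mem (Submodule.sub_starProjection_mem_orthogonal _) ?_
      rw [Submodule.mem_orthogonal]
      intro y hy
      rw [real_inner_comm]
      exact constants_le_orthogonal (-ε) u hy _ ha
    · exact absurd (hu n) (by rw [h, norm_zero]; exact zero_ne_one)
  rw [sub_sub, sub_eq_zero] at key
  rw [key]
  exact Submodule.add_mem_sup ha hb

/-- A polarization with a nonzero direction for every mode, together with a Lagrangian subspace of
the constants, is Lagrangian. -/
theorem isLagrangian_polarization_sup (ε : ℤˣ) {u : ℤ × ℤ → ℂ} (hu : ∀ n, ‖u n‖ = 1)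
    {Λ : Submodule ℝ L2} (hΛ : IsLagrangianIn constants Λ) :
    IsLagrangian (polarization ε u ⊔ Λ) := by
  rw [IsLagrangian, Submodule.map_sup, map_J_polarization, hΛ.2, ← Submodule.inf_orthogonal,
    polarization_orthogonal ε hu]
  -- modular law, as `polarization (-ε) u` is orthogonal to `Λ`
  have h : polarization (-ε) u ≤ Λᗮ := fun y hy => by
    rw [Submodule.mem_orthogonal]
    intro z hz
    rw [real_inner_comm]
    exact constants_le_orthogonal (-ε) u (hΛ.1 hz) y hy
  rw [inf_comm (Λᗮ), sup_inf_assoc_of_le _ h]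

/-! ### The splitting into `ℝi`- and `ℂj`-valued forms -/

theorem fiberwise_planePart_mem (ψ : L2) : fiberwise planePart ψ ∈ formsIn planeJ := by
  filter_upwards [coeFn_fiberwise planePart ψ] with x h c
  rw [h]
  exact planePart_mem _ c

theorem sub_fiberwise_planePart_mem (ψ : L2) : ψ - fiberwise planePart ψ ∈ formsIn lineI := by
  filter_upwards [coeFn_fiberwise planePart ψ, Lp.coeFn_sub ψ (fiberwise planePart ψ)] with x h h' c
  rw [h', Pi.sub_apply, h, ← linePart_apply]
  exact linePart_mem _ c

theorem fiberwise_planePart_modeForm (n : ℤ × ℤ) (w : Fiber) :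
    fiberwise planePart (modeForm n w) = modeForm n w := by
  rw [fiberwise_modeForm (fun w => by rw [planePart_fiberI, fiberI_planePart]),
    modeForm_planePart]

theorem fiberwise_planePart_lineForm (ε : ℤˣ) (n : ℤ × ℤ) (w : Fiber) :
    fiberwise planePart (lineForm ε n w) = 0 := by
  rw [lineForm, fiberwise_trigL2]
  simp only [planePart_linePart, map_neg, map_smul, planePart_symb, map_zero, fiber_smul_zero,
    neg_zero, ← Prod.zero_eq_mk]

theorem polarization_eq_sup (ε : ℤˣ) (u : ℤ × ℤ → ℂ) :
    (polarization ε u ⊓ formsIn lineI) ⊔ (polarization ε u ⊓ formsIn planeJ) =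
      polarization ε u := by
  refine le_antisymm (sup_le inf_le_left inf_le_left) fun x hx => ?_
  have h : polarization ε u ≤ (polarization ε u).comap (fiberwise planePart : L2 →ₗ[ℝ] L2) := by
    refine Submodule.topologicalClosure_minimal _ (Submodule.span_le.mpr ?_)
      ((isClosed_polarization _ _).preimage (fiberwise planePart).continuous)
    rintro _ (⟨n, w, hn, rfl⟩ | ⟨n, w, hw, rfl⟩)
    · change fiberwise planePart (lineForm ε n w) ∈ polarization ε u
      rw [fiberwise_planePart_lineForm]
      exact zero_mem _
    · change fiberwise planePart (modeForm n w) ∈ polarization ε u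
      rw [fiberwise_planePart_modeForm]
      exact modeForm_mem_polarization hw
  have h1 : fiberwise planePart x ∈ polarization ε u := h hx
  rw [← sub_add_cancel x (fiberwise planePart x)]
  exact Submodule.add_mem_sup ⟨sub_mem hx h1, sub_fiberwise_planePart_mem x⟩
    ⟨h1, fiberwise_planePart_mem x⟩

/-! ### Harmonic forms -/

theorem inner_planePart (w w' : Fiber) : inner ℝ (planePart w) w' = inner ℝ w (planePart w') := by
  simp only [planePart_apply, inner_neg_left, inner_neg_right, inner_fiberI, neg_neg]

theorem inner_modeForm_of_lineI {φ : Form} {ψ : L2} (hφ : ∀ x c, φ x c ∈ lineI)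
    (hψ : ψ =ᵐ[volume] φ) (n : ℤ × ℤ) (w : Fiber) : inner ℝ (modeForm n w) ψ = 0 := by
  rw [← fiberwise_planePart_modeForm, L2.inner_def]
  refine integral_eq_zero_of_ae ?_
  filter_upwards [coeFn_fiberwise planePart (modeForm n w), hψ] with x h1 h2
  rw [h1, h2, inner_planePart, planePart_eq_zero (hφ x), inner_zero_right, Pi.zero_apply]

/-- Harmonic forms are orthogonal to the eigenforms of `S` with nonzero eigenvalue, because `S` is
symmetric and `S ∘ S` is the Laplacian. -/
theorem inner_eigenforms_of_harmonic {φ : Form} {ψ ψ' : L2} (hφ : IsSmooth φ)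
    (h0 : laplacian trivialConn φ = 0) (hψ : ψ =ᵐ[volume] φ) {μ : ℝ} (hμ : μ ≠ 0)
    (h' : ψ' ∈ eigenforms (flatConn 0) μ) : inner ℝ ψ' ψ = 0 := by
  obtain ⟨φ', hs', he', hψ'⟩ := h'
  have e : inner ℝ ψ' ψ = ∫ x, inner ℝ (φ' x) (φ x) := by
    rw [L2.inner_def]
    refine integral_congr_ae ?_
    filter_upwards [hψ, hψ'] with x h1 h2
    rw [h1, h2]
  have h1 := integral_inner_deRhamOp 0 hs' hφ
  have h2 := integral_inner_deRhamOp 0 hs' (hφ.deRhamOp 0)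
  rw [← trivialConn_eq] at h1 h2 he'
  rw [deRhamOp_deRhamOp hφ, h0] at h2
  rw [he'] at h1 h2
  simp only [Pi.smul_apply, fiber_inner_smul_left, integral_const_mul, Pi.zero_apply,
    inner_zero_right, integral_zero] at h1 h2
  have h3 := (mul_eq_zero.mp h2).resolve_left hμ
  rw [← h1] at h3
  rw [e]
  exact (mul_eq_zero.mp h3).resolve_left hμ

theorem harmonicI_eq : harmonicI = constants := by
  refine le_antisymm (Submodule.span_le.mpr ?_) ?_
  · rintro ψ ⟨φ, hs, hI, h0, hψ⟩
    set b : L2 := constants.starProjection ψ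
    have hb : b ∈ constants := Submodule.starProjection_apply_mem _ _
    have hp : ∀ ε, ψ ∈ (polarization ε fun _ => 1)ᗮ := by
      intro ε
      refine mem_polarization_orthogonal ?_
      rintro _ (⟨n, w, hn, rfl⟩ | ⟨n, w, hw, rfl⟩)
      · exact inner_eigenforms_of_harmonic hs h0 hψ
          (mul_ne_zero (sgn_ne_zero ε) (norm_ne_zero_iff.mpr (freq_ne_zero hn)))
          (lineForm_mem_eigenforms 0 ε hn w)
      · exact inner_modeForm_of_lineI hI hψ n w
    have key : ψ - b = 0 := by
      refine eq_zero_of_orthogonal (ε := 1) (u := fun _ => 1) (fun n _ => norm_one) ?_ ?_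
        (Submodule.sub_starProjection_mem_orthogonal _) fun n w h => absurd h one_ne_zero
      · exact sub_mem (hp _) (constants_le_orthogonal _ _ hb)
      · exact sub_mem (hp _) (constants_le_orthogonal _ _ hb)
    rw [SetLike.mem_coe, sub_eq_zero.mp key]
    exact hb
  · rintro _ ⟨w, rfl⟩
    refine Submodule.subset_span ⟨trig 0 (linePart w, 0), isSmooth_trig _ _, fun x c => ?_, ?_,
      coeFn_trigL2 _ _⟩
    · rw [trig_apply, fiber_smul_zero, add_zero]
      exact lineI.smul_mem _ (linePart_mem w c)
    · have hz : ∀ w, symb 0 w = 0 := fun w => by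
        have h := symb_real_smul 0 0 w
        rwa [mul_zero, fiber_zero_smul] at h
      rw [← deRhamOp_deRhamOp (isSmooth_trig _ _), trivialConn_eq, deRhamOp_trig, deRhamOp_trig]
      simp [freq_zero, hz, ← Prod.zero_eq_mk]

/-! ### The limits of the spectral subspaces -/

/-- The limit of the directions `connDir (ρ + t θ)` for `t → 0⁺`: the mode whose frequency vanishes
at `ρ`, if there is one, gets the direction `-θ`. -/
def blowDir (ρ : ℂ) (θ : Circle) (n : ℤ × ℤ) : ℂ :=
  open Classical in if freq n = 2 * ρ then -(θ : ℂ) else connDir ρ n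

theorem blowDir_of_eq {ρ : ℂ} {n : ℤ × ℤ} (h : freq n = 2 * ρ) (θ : Circle) :
    blowDir ρ θ n = -(θ : ℂ) := if_pos h

theorem blowDir_of_ne {ρ : ℂ} {n : ℤ × ℤ} (h : freq n ≠ 2 * ρ) (θ : Circle) :
    blowDir ρ θ n = connDir ρ n := if_neg h

theorem norm_blowDir (ρ : ℂ) (θ : Circle) (n : ℤ × ℤ) : ‖blowDir ρ θ n‖ = 1 := by
  by_cases h : freq n = 2 * ρ
  · rw [blowDir_of_eq h, norm_neg, Circle.norm_coe]
  · rw [blowDir_of_ne h]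
    exact norm_connDir (mt connDir_eq_zero.mp h)

theorem norm_mul_blowDir (ρ : ℂ) (θ : Circle) (n : ℤ × ℤ) :
    (‖freq n - 2 * ρ‖ : ℂ) * blowDir ρ θ n = freq n - 2 * ρ := by
  by_cases h : freq n = 2 * ρ
  · simp [h]
  · rw [blowDir_of_ne h]
    exact norm_mul_unitVec _

/-- The distance of the directions of two vectors; the direction of a zero vector is arbitrary. -/
theorem norm_mul_norm_sub_le {a b v v' : ℂ} (hv : ‖v‖ = 1) (ha : (‖a‖ : ℂ) * v = a)
    (hb : (‖b‖ : ℂ) * v' = b) : ‖b‖ * ‖v - v'‖ ≤ 2 * ‖a - b‖ := by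
  have e : (‖b‖ : ℂ) * (v - v') = ((‖b‖ - ‖a‖ : ℝ) : ℂ) * v + (a - b) := by
    push_cast
    linear_combination ha - hb
  have h := congrArg norm e
  rw [norm_mul, Complex.norm_real, norm_norm] at h
  rw [h]
  refine (norm_add_le _ _).trans ?_
  rw [norm_mul, Complex.norm_real, hv, mul_one, Real.norm_eq_abs, abs_sub_comm]
  linarith [abs_norm_sub_norm_le a b]

theorem mem_halfLattice_of_freq {ρ : ℂ} {n : ℤ × ℤ} (h : freq n = 2 * ρ) : ρ ∈ halfLattice := by
  have h1 := congrArg Complex.re h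
  have h2 := congrArg Complex.im h
  simp only [freq, Complex.mul_re, Complex.mul_im, Complex.re_ofNat, Complex.im_ofNat, zero_mul,
    sub_zero, add_zero] at h1 h2
  exact ⟨n.1, n.2, Complex.ext (by simp only; linarith) (by simp only; linarith)⟩

theorem freq_div_two_mem (n : ℤ × ℤ) : freq n / 2 ∈ halfLattice :=
  mem_halfLattice_of_freq (n := n) (by rw [mul_div_cancel₀ _ two_ne_zero])

theorem norm_freq_sub (n : ℤ × ℤ) (ρ : ℂ) : ‖freq n - 2 * ρ‖ = 2 * ‖ρ - freq n / 2‖ := by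
  rw [show freq n - 2 * ρ = -(2 * (ρ - freq n / 2)) by ring, norm_neg, norm_mul, Complex.norm_ofNat]

/-- The nonzero frequencies with respect to `a_ρ` are bounded away from zero. -/
theorem exists_le_norm_freq_sub (ρ : ℂ) :
    ∃ δ > 0, ∀ n, freq n ≠ 2 * ρ → δ ≤ ‖freq n - 2 * ρ‖ := by
  by_cases h : ρ = nearest ρ
  · refine ⟨1 / 2, by norm_num, fun n hn => ?_⟩
    by_contra hc
    rw [norm_freq_sub] at hc
    have e := nearest_eq (z := ρ) (freq_div_two_mem n) (by linarith)
    rw [← h] at e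
    exact hn (by rw [e, mul_div_cancel₀ _ two_ne_zero])
  · have hpos : 0 < ‖ρ - nearest ρ‖ := norm_pos_iff.mpr (sub_ne_zero.mpr h)
    refine ⟨min (1 / 2) (2 * ‖ρ - nearest ρ‖), by positivity, fun n _ => ?_⟩
    by_contra hc
    rw [norm_freq_sub, not_le, lt_min_iff] at hc
    have e := nearest_eq (z := ρ) (freq_div_two_mem n) (by linarith [hc.1])
    rw [e] at hc
    exact lt_irrefl _ hc.2

theorem tendsto_gapProj_spectralSpace (ε : ℤˣ) (ρ : ℂ) (θ : Circle) :
    Tendsto (fun t : ℝ => gapProj (spectralSpace ε (flatConn (ρ + (t : ℂ) * (θ : ℂ)))))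
      (𝓝[>] 0) (𝓝 (gapProj (polarization ε (blowDir ρ θ)))) := by
  obtain ⟨δ, hδ, hn⟩ := exists_le_norm_freq_sub ρ
  obtain ⟨C, hC, h⟩ := exists_norm_gapProj_sub_le ε
  refine (tendsto_iff_norm_sub_tendsto_zero (E := L2 →L[ℝ] L2)).mpr ?_
  have hlim : Tendsto (fun t : ℝ => C * (4 / δ * t)) (𝓝[>] 0) (𝓝 0) := by
    have hc : Continuous fun t : ℝ => C * (4 / δ * t) := by fun_prop
    have := hc.tendsto 0
    simp only [mul_zero] at this
    exact this.mono_left nhdsWithin_le_nhds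
  refine squeeze_zero' (Eventually.of_forall fun t => norm_nonneg (E := L2 →L[ℝ] L2) _) ?_ hlim
  filter_upwards [Ioo_mem_nhdsGT (show (0 : ℝ) < δ / 2 by linarith)] with t ht
  have hdiff : ∀ n, (freq n - 2 * (ρ + t * θ)) - (freq n - 2 * ρ) = ((-(2 * t) : ℝ) : ℂ) * θ := by
    intro n
    push_cast
    ring
  have hnorm : ‖((-(2 * t) : ℝ) : ℂ) * (θ : ℂ)‖ = 2 * t := by
    rw [norm_mul, Circle.norm_coe, mul_one, Complex.norm_real, norm_neg,
      Real.norm_of_nonneg (by linarith [ht.1])]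
  have hne : ∀ n, freq n ≠ 2 * (ρ + t * θ) := by
    intro n hc
    have e := congrArg norm (hdiff n)
    rw [hnorm, hc, sub_self, zero_sub, norm_neg, ← hc] at e
    by_cases hr : freq n = 2 * ρ
    · rw [hr, sub_self, norm_zero] at e
      linarith [ht.1]
    · linarith [hn n hr, ht.2]
  rw [spectralSpace_flatConn]
  refine h _ _ _ (mul_nonneg (by positivity) ht.1.le)
    (fun n => norm_connDir (mt connDir_eq_zero.mp (hne n))) (norm_blowDir ρ θ) fun n => ?_
  rw [← blowDir_of_ne (hne n) θ]
  by_cases hr : freq n = 2 * ρ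
  · -- the frequency of this mode is exactly `-2tθ`
    have h1 := norm_mul_blowDir (ρ + t * θ) θ n
    have h2 := hdiff n
    rw [hr, sub_self, sub_zero, ← hr] at h2
    rw [h2, hnorm] at h1
    have ht0 : ((2 * t : ℝ) : ℂ) ≠ 0 := Complex.ofReal_ne_zero.mpr (by linarith [ht.1])
    have h3 : blowDir (ρ + t * θ) θ n = -(θ : ℂ) := by
      refine mul_left_cancel₀ ht0 (h1.trans ?_)
      push_cast
      ring
    rw [h3, blowDir_of_eq hr, sub_self, norm_zero]
    exact mul_nonneg (by positivity) ht.1.le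
  · have h1 := norm_mul_norm_sub_le (norm_blowDir (ρ + t * θ) θ n) (norm_mul_blowDir _ θ n)
      (norm_mul_blowDir ρ θ n)
    rw [hdiff, hnorm] at h1
    have h2 := mul_le_mul_of_nonneg_right (hn n hr)
      (norm_nonneg (blowDir (ρ + t * θ) θ n - blowDir ρ θ n))
    rw [div_mul_eq_mul_div, le_div_iff₀ hδ]
    linarith

theorem limitSpace_eq (ε : ℤˣ) (ρ : ℂ) (θ : Circle) :
    limitSpace ε ρ θ = polarization ε (blowDir ρ θ) :=
  gapLim_eq (isClosed_polarization _ _) (tendsto_gapProj_spectralSpace ε ρ θ)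

theorem spectralSpace_le_limitSpace (ε : ℤˣ) (ρ : ℂ) (θ : Circle) :
    spectralSpace ε (flatConn ρ) ≤ limitSpace ε ρ θ := by
  rw [limitSpace_eq, spectralSpace_flatConn]
  refine Submodule.topologicalClosure_minimal _ (Submodule.span_le.mpr ?_)
    (isClosed_polarization _ _)
  rintro _ (⟨n, w, hn, rfl⟩ | ⟨n, w, hw, rfl⟩)
  · exact lineForm_mem_polarization _ _ hn _
  · by_cases h : freq n = 2 * ρ
    · rw [connDir_eq_zero.mpr h] at hw
      rw [modeForm_eq_zero hw]
      exact zero_mem _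
    · rw [← blowDir_of_ne h θ] at hw
      exact modeForm_mem_polarization hw

theorem limitK_eq_bot (ε : ℤˣ) {ρ : ℂ} (θ : Circle) (h : ρ ∉ halfLattice) :
    limitK ε ρ θ = ⊥ := by
  have e : blowDir ρ θ = connDir ρ :=
    funext fun n => blowDir_of_ne (mt mem_halfLattice_of_freq h) θ
  rw [limitK, limitSpace_eq, spectralSpace_flatConn, e, Submodule.inf_orthogonal_eq_bot]

/-- The `ℝi`-part, the `ℂj`-part and `K` make up the whole limit of the spectral spaces. -/
theorem apsSpace_eq (ε : ℤˣ) (ρ : ℂ) (θ : Circle) (Λ : Submodule ℝ L2) :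
    apsSpace ε ρ θ Λ = polarization ε (blowDir ρ θ) ⊔ Λ := by
  have h := spectralSpace_le_limitSpace ε ρ θ
  rw [apsSpace, sup_sup_sup_comm, limitK]
  rw [spectralSpace_flatConn] at h ⊢
  rw [polarization_eq_sup, sup_comm Λ, ← sup_assoc, inf_comm (limitSpace ε ρ θ),
    Submodule.sup_orthogonal_inf_of_hasOrthogonalProjection h, limitSpace_eq]

/-! ### Continuity on the blown-up plane -/

theorem pt_mk (ρ : ℂ) (θ : Circle) : (BlowupPlane.mk ρ θ).pt = ρ := rfl

theorem blowDir_mk (ρ : ℂ) (θ : Circle) :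
    blowDir (BlowupPlane.mk ρ θ).pt (BlowupPlane.mk ρ θ).angle = blowDir ρ θ := by
  funext n
  rw [pt_mk]
  by_cases h : freq n = 2 * ρ
  · have e : (BlowupPlane.mk ρ θ).angle = θ := if_pos (mem_halfLattice_of_freq h)
    rw [e]
  · rw [blowDir_of_ne h, blowDir_of_ne h]

/-- The base point in the plane of the image of `z` under the bijection `blowupMap η`. -/
def basePoint (η : ℝ → ℝ) (z : ℂ) : ℂ :=
  nearest z + (η ‖z - nearest z‖ : ℂ) * (z - nearest z)

theorem pt_blowupMap (η : ℝ → ℝ) (z : PerforatedPlane) :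
    (blowupMap η z).pt = basePoint η z := rfl

/-- The directions of all modes at the image of `z` under `blowupMap η`. -/
def perforatedDir (η : ℝ → ℝ) (z : PerforatedPlane) : ℤ × ℤ → ℂ :=
  blowDir (blowupMap η z).pt (blowupMap η z).angle

theorem norm_perforatedDir (η : ℝ → ℝ) (z : PerforatedPlane) (n : ℤ × ℤ) :
    ‖perforatedDir η z n‖ = 1 := norm_blowDir _ _ n

section Cutoff

variable {η : ℝ → ℝ}

theorem IsCutoff.continuous_basePoint (hη : IsCutoff η) : Continuous (basePoint η) := by
  -- `basePoint η` differs from the identity by translates of a compactly supported function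
  let ξ : ℂ → ℂ := fun w => ((η ‖w‖ - 1 : ℝ) : ℂ) * w
  have hξc : Continuous ξ :=
    (Complex.continuous_ofReal.comp
      ((hη.smooth.continuous.comp continuous_norm).sub continuous_const)).mul continuous_id
  have hξ0 : ∀ w, 1 / 4 ≤ ‖w‖ → ξ w = 0 := fun w hw => by
    simp only [ξ, hη.one _ hw, sub_self, Complex.ofReal_zero, zero_mul]
  have hsupp : HasCompactSupport ξ :=
    HasCompactSupport.intro (isCompact_closedBall (0 : ℂ) (1 / 4)) fun w hw => hξ0 w (by
      rw [mem_closedBall_zero_iff, not_le] at hw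
      exact hw.le)
  have hu := hsupp.uniformContinuous_of_continuous hξc
  have e : basePoint η = fun z => z + ξ (z - nearest z) := by
    funext z
    simp only [basePoint, ξ]
    push_cast
    ring
  rw [e]
  refine continuous_id.add ?_
  rw [Metric.continuous_iff]
  intro z' r hr
  obtain ⟨δ, hδ, h⟩ := Metric.uniformContinuous_iff.mp hu (r / 2) (by linarith)
  refine ⟨δ, hδ, fun z hz => ?_⟩
  by_cases hn : nearest z = nearest z'
  · rw [hn]
    exact (h (by rwa [dist_sub_right])).trans (by linarith)
  · have hfar : ∀ x y : ℂ, nearest x ≠ nearest y → ξ (x - nearest y) = 0 := fun x y hxy =>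
      hξ0 _ (by
        by_contra hc
        exact hxy (nearest_eq (nearest_mem y) (not_le.mp hc)))
    have h1 := h (a := z - nearest z') (b := z' - nearest z') (by rwa [dist_sub_right])
    have h2 := h (a := z - nearest z) (b := z' - nearest z) (by rwa [dist_sub_right])
    rw [hfar z z' hn] at h1
    rw [hfar z' z (Ne.symm hn)] at h2
    calc dist (ξ (z - nearest z)) (ξ (z' - nearest z'))
        ≤ dist (ξ (z - nearest z)) 0 + dist 0 (ξ (z' - nearest z')) := dist_triangle _ _ _
      _ < r := by linarith

/-- Near `n / 2`, the mode `n` has the direction of `n / 2 - z`, also where the cutoff vanishes. -/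
theorem IsCutoff.norm_mul_perforatedDir (hη : IsCutoff η) (z : PerforatedPlane) {n : ℤ × ℤ}
    (hz : ‖(z : ℂ) - freq n / 2‖ < 1 / 4) :
    (‖freq n / 2 - z‖ : ℂ) * perforatedDir η z n = freq n / 2 - z := by
  have hp := nearest_eq (freq_div_two_mem n) hz
  have hw := z.2 _ (freq_div_two_mem n)
  have hw0 : (‖(z : ℂ) - freq n / 2‖ : ℂ) ≠ 0 := Complex.ofReal_ne_zero.mpr (by linarith)
  have hη0 : 0 ≤ η ‖(z : ℂ) - freq n / 2‖ := (hη.bij.mapsTo ⟨hw, hz.le⟩).1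
  obtain ⟨θ, hθ, hb⟩ : ∃ θ : Circle, (θ : ℂ) =
      ((z : ℂ) - freq n / 2) / (‖(z : ℂ) - freq n / 2‖ : ℂ) ∧
      blowupMap η z = BlowupPlane.mk (basePoint η z) θ :=
    ⟨_, by rw [← hp]; rfl, rfl⟩
  rw [perforatedDir, hb, blowDir_mk, norm_sub_rev]
  have hρ : freq n - 2 * basePoint η z =
      ((2 * η ‖(z : ℂ) - freq n / 2‖ : ℝ) : ℂ) * (freq n / 2 - z) := by
    rw [basePoint, hp]
    push_cast
    ring
  by_cases h : freq n = 2 * basePoint η z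
  · rw [blowDir_of_eq h, hθ, mul_neg, mul_div_cancel₀ _ hw0, neg_sub]
  · have h1 := norm_mul_blowDir (basePoint η z) θ n
    rw [hρ, norm_mul, Complex.norm_real, Real.norm_of_nonneg (by linarith),
      norm_sub_rev (freq n / 2), Complex.ofReal_mul, mul_assoc] at h1
    refine mul_left_cancel₀ (fun h0 => ?_) h1
    rw [h0, zero_mul] at hρ
    exact h (sub_eq_zero.mp hρ)

theorem IsCutoff.le_norm_basePoint_sub (hη : IsCutoff η) (z : PerforatedPlane) {n : ℤ × ℤ}
    (hz : 1 / 4 ≤ ‖(z : ℂ) - freq n / 2‖) : 1 / 4 ≤ ‖basePoint η z - freq n / 2‖ := by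
  rcases lt_or_ge ‖(z : ℂ) - nearest z‖ (1 / 4) with h | h
  · obtain ⟨a, b⟩ := hη.bij.mapsTo ⟨z.2 _ (nearest_mem z), h.le⟩
    by_contra hc
    have h1 := nearest_eq (freq_div_two_mem n) (not_le.mp hc)
    have h2 : nearest (basePoint η z) = nearest z := by
      refine nearest_eq (nearest_mem z) ?_
      rw [basePoint, add_sub_cancel_left, norm_mul, Complex.norm_real, Real.norm_of_nonneg a]
      exact (mul_le_of_le_one_left (norm_nonneg _) b).trans_lt h
    rw [← h1, h2] at hz
    linarith
  · rwa [basePoint, hη.one _ h, Complex.ofReal_one, one_mul, add_sub_cancel]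

/-- The directions of the modes are equicontinuous on the perforated plane. Near `z = n / 2` the
direction of the mode `n` is that of `n / 2 - z`, and elsewhere it is that of a vector of length at
least `1 / 2`. -/
theorem IsCutoff.norm_perforatedDir_sub_le (hη : IsCutoff η) (z z' : PerforatedPlane)
    (n : ℤ × ℤ) : ‖perforatedDir η z n - perforatedDir η z' n‖ ≤
      16 * ‖(z : ℂ) - z'‖ + 8 * ‖basePoint η z - basePoint η z'‖ := by
  have key : ∀ z z' : PerforatedPlane, 1 / 4 ≤ ‖(z' : ℂ) - freq n / 2‖ →
      ‖perforatedDir η z n - perforatedDir η z' n‖ ≤ 8 * ‖basePoint η z - basePoint η z'‖ := by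
    intro z z' h
    have h1 := hη.le_norm_basePoint_sub z' h
    have h2 := norm_mul_norm_sub_le (norm_perforatedDir η z n) (norm_mul_blowDir _ _ n)
      (norm_mul_blowDir (blowupMap η z').pt (blowupMap η z').angle n)
    rw [pt_blowupMap, pt_blowupMap, norm_freq_sub,
      show freq n - 2 * basePoint η z - (freq n - 2 * basePoint η z') =
        -(2 * (basePoint η z - basePoint η z')) by ring, norm_neg, norm_mul,
      Complex.norm_ofNat] at h2
    change 2 * _ * ‖perforatedDir η z n - perforatedDir η z' n‖ ≤ _ at h2
    nlinarith [norm_nonneg (perforatedDir η z n - perforatedDir η z' n)]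
  have hz0 := norm_nonneg ((z : ℂ) - z')
  have hb0 := norm_nonneg (basePoint η z - basePoint η z')
  rcases le_or_gt (1 / 4) ‖(z' : ℂ) - freq n / 2‖ with h' | h'
  · linarith [key z z' h']
  rcases le_or_gt (1 / 4) ‖(z : ℂ) - freq n / 2‖ with h | h
  · have := key z' z h
    rw [norm_sub_rev, norm_sub_rev (basePoint η z')] at this
    linarith
  · have h1 := norm_mul_norm_sub_le (norm_perforatedDir η z n) (hη.norm_mul_perforatedDir z h)
      (hη.norm_mul_perforatedDir z' h')
    have h2 := z'.2 _ (freq_div_two_mem n)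
    rw [norm_sub_rev (freq n / 2), sub_sub_sub_cancel_left, norm_sub_rev (z' : ℂ) z] at h1
    nlinarith [norm_nonneg (perforatedDir η z n - perforatedDir η z' n)]

theorem IsCutoff.continuous_gapProj_perforatedDir (hη : IsCutoff η) (ε : ℤˣ) :
    Continuous fun z : PerforatedPlane => gapProj (polarization ε (perforatedDir η z)) := by
  obtain ⟨C, hC, h⟩ := exists_norm_gapProj_sub_le ε
  rw [continuous_iff_continuousAt]
  intro z'
  refine (tendsto_iff_norm_sub_tendsto_zero (E := L2 →L[ℝ] L2)).mpr ?_
  refine squeeze_zero (fun z => norm_nonneg (E := L2 →L[ℝ] L2) _) (fun z => h _ _ _ (by positivity)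
    (norm_perforatedDir η z) (norm_perforatedDir η z') (hη.norm_perforatedDir_sub_le z z')) ?_
  have hc : Continuous fun z : PerforatedPlane =>
      C * (16 * ‖(z : ℂ) - z'‖ + 8 * ‖basePoint η z - basePoint η z'‖) := by
    have := hη.continuous_basePoint.comp (continuous_subtype_val (p := fun z : ℂ =>
      ∀ p ∈ halfLattice, 1 / 8 ≤ ‖z - p‖))
    have h2 : Continuous fun z : PerforatedPlane => basePoint η z := this
    fun_prop
  have := hc.tendsto z'
  simpa using this

theorem IsCutoff.isContinuousFamily_apsFamily (hη : IsCutoff η) (ε : ℤˣ) {U : Set BlowupPlane}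
    {L : U → Submodule ℝ L2} (hL : ∀ u, IsLagrangianIn harmonicI (L u))
    (hc : IsContinuousFamily η L) : IsContinuousFamily η (apsFamily ε L) := by
  let _ : TopologicalSpace BlowupPlane := blowupTopology η
  have h1 : Continuous fun u : BlowupPlane => gapProj (polarization ε (blowDir u.pt u.angle)) :=
    continuous_coinduced_dom.mpr (hη.continuous_gapProj_perforatedDir ε)
  have h2 : Continuous fun u : U => gapProj (L u) := hc
  have h3 := (h1.comp (continuous_subtype_val (p := fun u => u ∈ U))).add h2
  change Continuous fun u : U => gapProj (apsFamily ε L u)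
  convert h3 using 2 with u
  rw [apsFamily, apsSpace_eq]
  refine gapProj_sup (le_trans ?_ (constants_le_orthogonal ε _))
  rw [← harmonicI_eq]
  exact (hL u).1

end Cutoff

theorem isLagrangian_apsSpace (ε : ℤˣ) (ρ : ℂ) (θ : Circle) {Λ : Submodule ℝ L2}
    (hΛ : IsLagrangianIn harmonicI Λ) : IsLagrangian (apsSpace ε ρ θ Λ) := by
  rw [harmonicI_eq] at hΛ
  rw [apsSpace_eq]
  exact isLagrangian_polarization_sup ε (norm_blowDir ρ θ) hΛ

theorem isAPSBoundaryCondition_apsSpace (ε : ℤˣ) (ρ : ℂ) (θ : Circle) {Λ : Submodule ℝ L2}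
    (hΛ : IsLagrangianIn harmonicI Λ) :
    IsAPSBoundaryCondition ε (flatConn ρ) (apsSpace ε ρ θ Λ) := by
  refine ⟨isLagrangian_apsSpace ε ρ θ hΛ, 0, fun μ hμ ψ hψ => ?_⟩
  rw [apsSpace_eq, ← limitSpace_eq]
  exact Submodule.mem_sup_left (spectralSpace_le_limitSpace ε ρ θ
    (Submodule.le_topologicalClosure _ (Submodule.subset_span ⟨μ, hμ, hψ⟩)))

end TorusAPS

end

open TorusAPS
theorem theorem3 (ε : ℤˣ) :
    -- the limits that define `K^±` exist in the gap topology and contain `P^±`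
    (∀ (ρ : ℂ) (θ : Circle),
      Tendsto (fun t : ℝ => gapProj (spectralSpace ε (flatConn (ρ + (t : ℂ) * (θ : ℂ)))))
        (𝓝[>] 0) (𝓝 (gapProj (limitSpace ε ρ θ))) ∧
      spectralSpace ε (flatConn ρ) ≤ limitSpace ε ρ θ) ∧
    -- `K^±` vanishes away from the half integer lattice, so that it is well defined on the quotient
    (∀ (ρ : ℂ) (θ : Circle), ρ ∉ halfLattice → limitK ε ρ θ = ⊥) ∧
    -- the family is a continuous family of Lagrangian subspaces and APS boundary conditions
    ∀ (η : ℝ → ℝ), IsCutoff η →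
      ∀ (U : Set BlowupPlane) (L : U → Submodule ℝ L2),
        (∀ u, IsLagrangianIn harmonicI (L u)) →
        IsContinuousFamily η L →
        (∀ u, IsLagrangian (apsFamily ε L u)) ∧
        (∀ u, IsAPSBoundaryCondition ε (flatConn u.1.pt) (apsFamily ε L u)) ∧
        IsContinuousFamily η (apsFamily ε L) := by
  refine ⟨fun ρ θ => ⟨?_, spectralSpace_le_limitSpace ε ρ θ⟩, fun ρ θ => limitK_eq_bot ε θ,
    fun η hη U L hL hc => ⟨fun u => isLagrangian_apsSpace ε _ _ (hL u),
      fun u => isAPSBoundaryCondition_apsSpace ε _ _ (hL u),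
      hη.isContinuousFamily_apsFamily ε hL hc⟩⟩
  rw [limitSpace_eq]
  exact tendsto_gapProj_spectralSpace ε ρ θ
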